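/- Let $D$ be a regular dodecahedron in oriented Euclidean $3$-space centered at the origin, $\mathcal I\cong\mathcal A_5$ its group of rotations, $\iota$ the antipodal map, and $\mathcal K$ the set of the five cubes inscribed in $D$, on which $\mathcal I$ acts by all even permutations. Let $V_o=\mathbb Z^{\mathcal K}/\mathbb Z\cdot\sum_{e\in\mathcal K}e$, a $\mathbb Z\mathcal I$-module. Let $\Sigma$ be the closed oriented surface of genus $10$ that is obtained from $D$ by removing, $\mathcal I$- and $\iota$-equivariantly, a small open triangle around each vertex and identifying opposite points of the boundary by means of $\iota$. Then $\mathcal I$ acts on $\Sigma$ and its natural cell structure ($30$ $0$-cells, $30$ $1$-cells coming from the edges of $D$, $30$ $1$-cells coming from the boundary triangles, $12$ $2$-cells), and $H_1(\Sigma)$ denotes its integral (cellular) homology with the intersection pairing $\langle\ ,\ \rangle$. For an oriented edge $y$ of $D$ let $\delta_y\in H_1(\Sigma)$ be the class of the loop $y-\iota y$ that runs along $y$ and returns along the opposite edge, and for a vertex $x$ of $D$ let $\delta_x\in H_1(\Sigma)$ be the class of the counterclockwise boundary of the triangle removed at $x$. Let $L_{\mathrm{edge}}$ be the span of the $\delta_y$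 and $L_{\mathrm{trc}}$ the span of the $\delta_x$ in $H_1(\Sigma)$. (These are the lattices spanned by the vanishing cycles of the two degenerations of $\Sigma$ that contract the loops of the one or the other type; equivalently, the kernels of the maps from $H_1(\Sigma)$ to the first homology of the degenerate surface.) **Theorem.** Let $L$ be $L_{\mathrm{edge}}$ or $L_{\mathrm{trc}}$, let $L^\vee=\mathrm{Hom}_{\mathbb Z}(L,\mathbb Z)$ be its dual $\mathbb Z\mathcal I$-module and let $\phi:H_1(\Sigma)\to L^\vee$ be the map $h\mapsto\langle h,\cdot\rangle|_L$. Then the induced map $\mathrm{Hom}_{\mathbb Z\mathcal I}(V_o,H_1(\Sigma))\to\mathrm{Hom}_{\mathbb Z\mathcal I}(V_o,L^\vee)$ is onto, and the sequence $$0\to\mathrm{Hom}_{\mathbb Z\mathcal I}(V_o,L)\to\mathrm{Hom}_{\mathbb Z\mathcal I}(V_o,H_1(\Sigma))\to\mathrm{Hom}_{\mathbb Z\mathcal I}(V_o,L^\vee)\to0,$$ in which the first map is induced by the inclusion $L\subset H_1(\Sigma)$ and the second by $\phi$, is exact. -/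

import Mathlib

namespace Winger

/-! ### The dodecahedron

The five cubes inscribed in the regular dodecahedron `D` are numbered by `Fin 5`; this identifies
the rotation group of `D` with the alternating group of `Fin 5`. A vertex of `D` lies on exactly two
inscribed cubes, and the orientation of space orders this pair, so that the vertices of `D` are the
pairs `(a, b)` with `a ≠ b`. The vertices adjacent to `(a, b)` are the `(c, d)` for which
`(a, b, c, d, e)` is an even permutation of `Fin 5`. Hence an oriented edge of `D` is an even
permutation `y = (a, b, c, d, e)`; it runs from `(a, b)` to `(c, d)`. Rotations act on everything
through their action on the five cubes, hence on oriented edges by left multiplication.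
The theorem `dodecahedron_realization` below checks this description against the regular
dodecahedron in `ℝ³`. -/

/-- The icosahedral group, as the group of even permutations of the five inscribed cubes. -/
abbrev Icosa : Type := alternatingGroup (Fin 5)

/-- The oriented edges of the dodecahedron. -/
abbrev Dart : Type := alternatingGroup (Fin 5)

/-- Right multiplication by this element reverses oriented edges. -/
def revElt : Icosa := ⟨Equiv.swap 0 2 * Equiv.swap 1 3, by
  rw [Equiv.Perm.mem_alternatingGroup]; decide⟩

/-- Right multiplication by this element is the antipodal map on oriented edges. -/
def antiElt : Icosa := ⟨Equiv.swap 0 1 * Equiv.swap 2 3, by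
  rw [Equiv.Perm.mem_alternatingGroup]; decide⟩

/-- Right multiplication by this element rotates oriented edges about their initial point. -/
def rotElt : Icosa := ⟨Equiv.swap 2 3 * Equiv.swap 3 4, by
  rw [Equiv.Perm.mem_alternatingGroup]; decide⟩

/-- Orientation reversal `(a, b, c, d, e) ↦ (c, d, a, b, e)`. -/
def rev (y : Dart) : Dart := y * revElt

/-- The antipodal map `(a, b, c, d, e) ↦ (b, a, d, c, e)`. -/
def anti (y : Dart) : Dart := y * antiElt

/-- `(a, b, c, d, e) ↦ (a, b, d, e, c)`: the next oriented edge with the same initial point, in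
counterclockwise order as seen from outside the dodecahedron. -/
def rot (y : Dart) : Dart := y * rotElt

/-- The inverse of `rot`. -/
def rotInv (y : Dart) : Dart := y * rotElt⁻¹

/-- The two cubes through the initial point of an oriented edge: `in(y) = (y 0, y 1)`. -/
def initPt (y : Dart) : Fin 5 × Fin 5 := ((y : Equiv.Perm (Fin 5)) 0, (y : Equiv.Perm (Fin 5)) 1)

@[simp] lemma rev_rev (y : Dart) : rev (rev y) = y := by
  have h : revElt * revElt = 1 := by decide
  simp [rev, mul_assoc, h]

@[simp] lemma anti_anti (y : Dart) : anti (anti y) = y := by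
  have h : antiElt * antiElt = 1 := by decide
  simp [anti, mul_assoc, h]

@[simp] lemma rot_rotInv (y : Dart) : rot (rotInv y) = y := by simp [rot, rotInv]

@[simp] lemma rotInv_rot (y : Dart) : rotInv (rot y) = y := by simp [rot, rotInv]

@[simp] lemma rot_rot (y : Dart) : rot (rot y) = rotInv y := by
  have h : rotElt * rotElt = rotElt⁻¹ := by decide
  simp [rot, rotInv, mul_assoc, h]

@[simp] lemma rotInv_rotInv (y : Dart) : rotInv (rotInv y) = rot y := by
  have h : rotElt⁻¹ * rotElt⁻¹ = rotElt := by decide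
  simp [rot, rotInv, mul_assoc, h]

@[simp] lemma anti_rev (y : Dart) : anti (rev y) = rev (anti y) := by
  have h : revElt * antiElt = antiElt * revElt := by decide
  simp [rev, anti, mul_assoc, h]

@[simp] lemma anti_rot (y : Dart) : anti (rot y) = rotInv (anti y) := by
  have h : rotElt * antiElt = antiElt * rotElt⁻¹ := by decide
  simp [rot, rotInv, anti, mul_assoc, h]

@[simp] lemma anti_rotInv (y : Dart) : anti (rotInv y) = rot (anti y) := by
  have h : rotElt⁻¹ * antiElt = antiElt * rotElt := by decide
  simp [rot, rotInv, anti, mul_assoc, h]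

@[simp] lemma mul_rev (g : Icosa) (y : Dart) : g * rev y = rev (g * y) := by
  simp [rev, mul_assoc]

@[simp] lemma mul_anti (g : Icosa) (y : Dart) : g * anti y = anti (g * y) := by
  simp [anti, mul_assoc]

@[simp] lemma mul_rot (g : Icosa) (y : Dart) : g * rot y = rot (g * y) := by
  simp [rot, mul_assoc]

@[simp] lemma mul_rotInv (g : Icosa) (y : Dart) : g * rotInv y = rotInv (g * y) := by
  simp [rotInv, mul_assoc]

/-! ### Comparison with the regular dodecahedron in `ℝ³` -/

/-- Coordinates of the vertices of a regular dodecahedron; the pair `(p, q)` stands for `p + q φ`,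
where `φ` is the golden ratio. -/
def vertexCoord : Fin 5 → Fin 5 → Fin 3 → ℤ × ℤ :=
  ![![![(0, 0), (0, 0), (0, 0)], ![(1, 0), (1, 0), (1, 0)], ![(0, -1), (0, 0), (-1, 1)],
      ![(-1, 1), (0, -1), (0, 0)], ![(0, 0), (-1, 1), (0, -1)]],
    ![![(-1, 0), (-1, 0), (-1, 0)], ![(0, 0), (0, 0), (0, 0)], ![(1, 0), (-1, 0), (1, 0)],
      ![(1, 0), (1, 0), (-1, 0)], ![(-1, 0), (1, 0), (1, 0)]],
    ![![(0, 1), (0, 0), (1, -1)], ![(-1, 0), (1, 0), (-1, 0)], ![(0, 0), (0, 0), (0, 0)],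
      ![(0, 0), (-1, 1), (0, 1)], ![(1, -1), (0, -1), (0, 0)]],
    ![![(1, -1), (0, 1), (0, 0)], ![(-1, 0), (-1, 0), (1, 0)], ![(0, 0), (1, -1), (0, -1)],
      ![(0, 0), (0, 0), (0, 0)], ![(0, 1), (0, 0), (-1, 1)]],
    ![![(0, 0), (1, -1), (0, 1)], ![(1, 0), (-1, 0), (-1, 0)], ![(-1, 1), (0, 1), (0, 0)],
      ![(0, -1), (0, 0), (1, -1)], ![(0, 0), (0, 0), (0, 0)]]]

/-- The real number `p + q φ`. -/
noncomputable def goldenVal (x : ℤ × ℤ) : ℝ := x.1 + x.2 * Real.goldenRatio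

/-- The position in `ℝ³` of the vertex that lies on the cubes `a` and `b`, in this order. -/
noncomputable def vertexPos (p : Fin 5 × Fin 5) (i : Fin 3) : ℝ :=
  goldenVal (vertexCoord p.1 p.2 i)

/-- The product in `ℤ[φ]`. -/
def goldenMul (x y : ℤ × ℤ) : ℤ × ℤ := (x.1 * y.1 + x.2 * y.2, x.1 * y.2 + x.2 * y.1 + x.2 * y.2)

lemma goldenVal_mul (x y : ℤ × ℤ) : goldenVal (goldenMul x y) = goldenVal x * goldenVal y := by
  simp only [goldenVal, goldenMul]
  push_cast
  linear_combination (-(x.2 : ℝ) * y.2) * Real.goldenRatio_sq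

lemma goldenVal_add (x y : ℤ × ℤ) : goldenVal (x + y) = goldenVal x + goldenVal y := by
  simp only [goldenVal, Prod.fst_add, Prod.snd_add]; push_cast; ring

lemma goldenVal_sub (x y : ℤ × ℤ) : goldenVal (x - y) = goldenVal x - goldenVal y := by
  simp only [goldenVal, Prod.fst_sub, Prod.snd_sub]; push_cast; ring

lemma goldenVal_neg (x : ℤ × ℤ) : goldenVal (-x) = - goldenVal x := by
  simp only [goldenVal, Prod.fst_neg, Prod.snd_neg]; push_cast; ring

lemma goldenVal_injective : Function.Injective goldenVal := by
  intro x y h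
  simp only [goldenVal] at h
  have h2 : x.2 = y.2 := by
    by_contra hne
    have hne' : ((x.2 - y.2 : ℤ) : ℝ) ≠ 0 := by exact_mod_cast sub_ne_zero.2 hne
    refine Real.goldenRatio_irrational ⟨((y.1 - x.1 : ℤ) : ℚ) / ((x.2 - y.2 : ℤ) : ℚ), ?_⟩
    push_cast at hne' ⊢
    rw [div_eq_iff hne']
    linarith
  rw [h2] at h
  have h1 : (x.1 : ℝ) = y.1 := by linarith
  exact Prod.ext (by exact_mod_cast h1) h2

/-- The inner product in coordinates. -/
def coordDot (u v : Fin 3 → ℤ × ℤ) : ℤ × ℤ :=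
  goldenMul (u 0) (v 0) + goldenMul (u 1) (v 1) + goldenMul (u 2) (v 2)

lemma vertexPos_dot (p q : Fin 5 × Fin 5) : vertexPos p ⬝ᵥ vertexPos q =
    goldenVal (coordDot (vertexCoord p.1 p.2) (vertexCoord q.1 q.2)) := by
  simp [dotProduct, Fin.sum_univ_three, vertexPos, coordDot, goldenVal_add, goldenVal_mul]

/-- The cross product in coordinates. -/
def coordCross (u v : Fin 3 → ℤ × ℤ) : Fin 3 → ℤ × ℤ :=
  ![goldenMul (u 1) (v 2) - goldenMul (u 2) (v 1), goldenMul (u 2) (v 0) - goldenMul (u 0) (v 2),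
    goldenMul (u 0) (v 1) - goldenMul (u 1) (v 0)]

lemma vertexPos_det (p q r : Fin 5 × Fin 5) :
    vertexPos p ⬝ᵥ crossProduct (vertexPos q) (vertexPos r) =
      goldenVal (coordDot (vertexCoord p.1 p.2)
        (coordCross (vertexCoord q.1 q.2) (vertexCoord r.1 r.2))) := by
  simp [dotProduct, cross_apply, Fin.sum_univ_three, vertexPos, coordDot, coordCross,
    goldenVal_add, goldenVal_mul, goldenVal_sub]

lemma sqrt_five_eq : √5 = goldenVal (-1, 2) := by
  simp only [goldenVal, Real.goldenRatio]; push_cast; ring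

/-- The combinatorial description of the dodecahedron is the correct one: the points
`vertexPos (a, b)` with `a ≠ b` are the twenty vertices `(±1, ±1, ±1)`, `(0, ±φ⁻¹, ±φ)`,
`(±φ, 0, ±φ⁻¹)`, `(±φ⁻¹, ±φ, 0)` of a regular dodecahedron centered at the origin; the oriented
edges `y` are the ordered pairs of vertices at minimal distance (those with inner product `√5`);
opposite vertices are `(a, b)` and `(b, a)`; `rot` is a counterclockwise rotation; and for each `a`
the points `(a, b)` are the vertices of a regular tetrahedron, so that together with their opposites
they are the vertices of an inscribed cube. -/
theorem dodecahedron_realization :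
    (∀ v : Fin 3 → ℝ, (∃ a b, a ≠ b ∧ vertexPos (a, b) = v) ↔
      (∀ i, v i ^ 2 = 1) ∨ ∃ i, v i = 0 ∧ v (i + 1) ^ 2 = (Real.goldenRatio⁻¹) ^ 2 ∧
        v (i + 2) ^ 2 = Real.goldenRatio ^ 2) ∧
    (∀ a b c d, a ≠ b → vertexPos (a, b) = vertexPos (c, d) → a = c ∧ b = d) ∧
    (∀ a b c d, a ≠ b → c ≠ d → (vertexPos (a, b) ⬝ᵥ vertexPos (c, d) = √5 ↔
      ∃ y : Dart, initPt y = (a, b) ∧ initPt (rev y) = (c, d))) ∧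
    (∀ a b, vertexPos (b, a) = - vertexPos (a, b)) ∧
    (∀ y : Dart, initPt (anti y) = (initPt y).swap) ∧
    (∀ y : Dart, initPt (rot y) = initPt y ∧
      0 < vertexPos (initPt y) ⬝ᵥ
        crossProduct (vertexPos (initPt (rev y))) (vertexPos (initPt (rev (rot y))))) ∧
    (∀ a b c, a ≠ b → a ≠ c → b ≠ c → vertexPos (a, b) ⬝ᵥ vertexPos (a, c) = -1) := by
  have g1 : (1 : ℝ) = goldenVal (1, 0) := by simp [goldenVal]
  have g0 : (0 : ℝ) = goldenVal (0, 0) := by simp [goldenVal]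
  have gp : Real.goldenRatio = goldenVal (0, 1) := by simp [goldenVal]
  have gi : Real.goldenRatio⁻¹ = goldenVal (-1, 1) := by
    have := Real.goldenRatio_add_goldenConj
    rw [Real.inv_goldenRatio]; simp [goldenVal]; linarith
  have gneg : ∀ x : ℤ × ℤ, - goldenVal x = goldenVal (-x) := fun x => (goldenVal_neg x).symm
  refine ⟨fun v => ⟨?_, ?_⟩, ?_, ?_, ?_, ?_, ?_, ?_⟩
  · rintro ⟨a, b, hab, rfl⟩
    have h : ∀ a b : Fin 5, a ≠ b →
        (∀ i, goldenMul (vertexCoord a b i) (vertexCoord a b i) = (1, 0)) ∨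
        ∃ i, vertexCoord a b i = (0, 0) ∧
          goldenMul (vertexCoord a b (i + 1)) (vertexCoord a b (i + 1)) =
            goldenMul (-1, 1) (-1, 1) ∧
          goldenMul (vertexCoord a b (i + 2)) (vertexCoord a b (i + 2)) =
            goldenMul (0, 1) (0, 1) := by decide
    rw [gi, gp]
    simp only [vertexPos, sq, ← goldenVal_mul]
    rcases h a b hab with h | ⟨i, h0, h1, h2⟩
    · exact Or.inl fun i => by rw [h i, ← g1]
    · exact Or.inr ⟨i, by rw [h0, ← g0], by rw [h1], by rw [h2]⟩
  · have h1 : ∀ s ∈ [((1 : ℤ), (0 : ℤ)), (-1, 0)], ∀ t ∈ [((1 : ℤ), (0 : ℤ)), (-1, 0)],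
        ∀ r ∈ [((1 : ℤ), (0 : ℤ)), (-1, 0)], ∃ a b : Fin 5, a ≠ b ∧
          vertexCoord a b 0 = s ∧ vertexCoord a b 1 = t ∧ vertexCoord a b 2 = r := by decide
    have h2 : ∀ i : Fin 3, ∀ s ∈ [((-1 : ℤ), (1 : ℤ)), (1, -1)], ∀ t ∈ [((0 : ℤ), (1 : ℤ)), (0, -1)],
        ∃ a b : Fin 5, a ≠ b ∧ vertexCoord a b i = (0, 0) ∧ vertexCoord a b (i + 1) = s ∧
          vertexCoord a b (i + 2) = t := by decide
    rintro (h | ⟨i, h0, hs, ht⟩)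
    · have hv : ∀ i, ∃ s ∈ [((1 : ℤ), (0 : ℤ)), (-1, 0)], v i = goldenVal s := fun i => by
        rcases mul_self_eq_one_iff.1 ((sq (v i)).symm.trans (h i)) with h | h
        · exact ⟨(1, 0), by simp, by rw [h, g1]⟩
        · exact ⟨(-1, 0), by simp, by rw [h, g1, gneg]; rfl⟩
      obtain ⟨s, hs, hs'⟩ := hv 0
      obtain ⟨t, ht, ht'⟩ := hv 1
      obtain ⟨r, hr, hr'⟩ := hv 2
      obtain ⟨a, b, hab, e0, e1, e2⟩ := h1 s hs t ht r hr
      refine ⟨a, b, hab, ?_⟩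
      funext j
      fin_cases j
      · simp [vertexPos, e0, hs']
      · simp [vertexPos, e1, ht']
      · simp [vertexPos, e2, hr']
    · have hs1 : ∃ s ∈ [((-1 : ℤ), (1 : ℤ)), (1, -1)], v (i + 1) = goldenVal s := by
        rcases sq_eq_sq_iff_eq_or_eq_neg.1 hs with h | h
        · exact ⟨(-1, 1), by simp, by rw [h, gi]⟩
        · exact ⟨(1, -1), by simp, by rw [h, gi, gneg]; rfl⟩
      have ht1 : ∃ s ∈ [((0 : ℤ), (1 : ℤ)), (0, -1)], v (i + 2) = goldenVal s := by
        rcases sq_eq_sq_iff_eq_or_eq_neg.1 ht with h | h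
        · exact ⟨(0, 1), by simp, by rw [h, gp]⟩
        · exact ⟨(0, -1), by simp, by rw [h, gp, gneg]; rfl⟩
      obtain ⟨s, hs, hs'⟩ := hs1
      obtain ⟨t, ht, ht'⟩ := ht1
      obtain ⟨a, b, hab, e0, e1, e2⟩ := h2 i s hs t ht
      refine ⟨a, b, hab, ?_⟩
      funext j
      have h3 : ∀ i j : Fin 3, j = i ∨ j = i + 1 ∨ j = i + 2 := by decide
      obtain rfl | rfl | rfl := h3 i j
      · simp [vertexPos, e0, h0, ← g0]
      · simp [vertexPos, e1, hs']
      · simp [vertexPos, e2, ht']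
  · intro a b c d hab h
    have h' : ∀ a b c d : Fin 5, a ≠ b → (∀ i, vertexCoord a b i = vertexCoord c d i) →
        a = c ∧ b = d := by decide
    exact h' a b c d hab fun i => goldenVal_injective (congrFun h i)
  · intro a b c d hab hcd
    have h : ∀ a b c d : Fin 5, a ≠ b → c ≠ d →
        coordDot (vertexCoord a b) (vertexCoord c d) = (-1, 2) →
          ∃ y : Dart, initPt y = (a, b) ∧ initPt (rev y) = (c, d) := by decide +kernel
    have h' : ∀ y : Dart, coordDot (vertexCoord (initPt y).1 (initPt y).2)
        (vertexCoord (initPt (rev y)).1 (initPt (rev y)).2) = (-1, 2) := by decide +kernel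
    rw [vertexPos_dot, sqrt_five_eq, goldenVal_injective.eq_iff]
    refine ⟨h a b c d hab hcd, ?_⟩
    rintro ⟨y, hy, hy'⟩
    simpa [hy, hy'] using h' y
  · intro a b
    have h : ∀ a b : Fin 5, ∀ i, vertexCoord b a i = - vertexCoord a b i := by decide
    funext i
    simp [vertexPos, h a b i, goldenVal_neg]
  · decide
  · have h : ∀ y : Dart, initPt (rot y) = initPt y := by decide
    have h' : ∀ y : Dart, coordDot (vertexCoord (initPt y).1 (initPt y).2)
        (coordCross (vertexCoord (initPt (rev y)).1 (initPt (rev y)).2)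
          (vertexCoord (initPt (rev (rot y))).1 (initPt (rev (rot y))).2)) = (2, 0) := by
      decide +kernel
    intro y
    refine ⟨h y, ?_⟩
    rw [vertexPos_det, h' y]
    simp [goldenVal]
  · intro a b c hab hac hbc
    have h : ∀ a b c : Fin 5, a ≠ b → a ≠ c → b ≠ c →
        coordDot (vertexCoord a b) (vertexCoord a c) = (-1, 0) := by decide
    rw [vertexPos_dot, h a b c hab hac hbc]
    simp [goldenVal]

/-! ### Representations on integral functions, and the lattice `V_o` -/

/-- The representation of the icosahedral group on integral functions on a set on which it acts,
`(g f) x = f (g⁻¹ x)`. -/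
def funRep (X : Type) [MulAction Icosa X] : Representation ℤ Icosa (X → ℤ) where
  toFun g :=
    { toFun := fun f x => f (g⁻¹ • x)
      map_add' := fun _ _ => rfl
      map_smul' := fun _ _ => rfl }
  map_one' := by ext; simp
  map_mul' g h := by
    apply LinearMap.ext
    intro f
    funext x
    simp [mul_smul]

lemma funRep_apply {X : Type} [MulAction Icosa X] (g : Icosa) (f : X → ℤ) (x : X) :
    funRep X g f x = f (g⁻¹ • x) := rfl

/-- The line of constant functions in `ℤ^5`. -/
def constLine : Submodule ℤ (Fin 5 → ℤ) := Submodule.span ℤ {fun _ => 1}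

lemma constLine_le (g : Icosa) : constLine ≤ constLine.comap (funRep (Fin 5) g) := by
  rw [constLine, Submodule.span_le]
  rintro _ rfl
  exact Submodule.subset_span rfl

/-- The lattice `V_o = ℤ^K / ℤ`, where `K` is the set of the five inscribed cubes and `ℤ` is the
main diagonal. -/
abbrev Vo : Type := (Fin 5 → ℤ) ⧸ constLine

/-- `V_o` as a representation of the icosahedral group. -/
def VoRep : Representation ℤ Icosa Vo := (funRep (Fin 5)).quotient constLine constLine_le

/-! ### The surface `Σ` and its cellular chain complex

`Σ` is the dodecahedron with a small triangle removed at each vertex, opposite boundary points being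
identified. Its cells are as follows.
* `0`-cells: on the truncated dodecahedron every oriented edge `y` has a point `P y` on it near its
  initial point, and on `Σ` we have `P (anti y) = P y`.
* oriented `1`-cells of edge type: `e y`, from `P y` to `P (rev y)`, with `e (rev y) = - e y`.
* oriented `1`-cells of truncation type: `t y`, from `P (rot y)` to `P (rotInv y)`, the side of the
  boundary triangle at the initial point of `y` that does not contain `P y`. On `Σ`,
  the antipodal identification gives `t (anti y) = - t y`.
* `2`-cells: the decagons inside the faces of the dodecahedron. The face on the left hand side of
  an oriented edge `y` has `rotInv (rev y)` as its next counterclockwise oriented edge.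

Chains are written as integral functions on oriented edges: a function `c` on oriented `1`-cells
with `c (- x) = - c x` stands for the sum of `c x • x` over the unoriented `1`-cells, and likewise
for `0`-cells and `2`-cells. -/

/-- Functions on oriented cells, for the `1`-cells of edge type and of truncation type. -/
abbrev PreC1 : Type := (Dart → ℤ) × (Dart → ℤ)

/-- The `0`-chains of `Σ`. -/
def C0 : Submodule ℤ (Dart → ℤ) where
  carrier := {c | ∀ y, c (anti y) = c y}
  add_mem' ha hb y := by simp [ha y, hb y]
  zero_mem' _ := rfl
  smul_mem' r a ha y := by simp [ha y]

/-- The `1`-chains of `Σ`: the sum of the `1`-chains of edge and of truncation type. -/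
def C1 : Submodule ℤ PreC1 where
  carrier := {c | (∀ y, c.1 (rev y) = - c.1 y) ∧ ∀ y, c.2 (anti y) = - c.2 y}
  add_mem' ha hb := ⟨fun y => by simp [ha.1 y, hb.1 y]; ring, fun y => by simp [ha.2 y, hb.2 y]; ring⟩
  zero_mem' := ⟨fun _ => by simp, fun _ => by simp⟩
  smul_mem' r a ha := ⟨fun y => by simp [ha.1 y], fun y => by simp [ha.2 y]⟩

/-- The `2`-chains of `Σ`: the value at `y` is the coefficient of the face on the left of `y`. -/
def C2 : Submodule ℤ (Dart → ℤ) where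
  carrier := {f | ∀ y, f (rotInv (rev y)) = f y}
  add_mem' ha hb y := by simp [ha y, hb y]
  zero_mem' _ := rfl
  smul_mem' r a ha y := by simp [ha y]

/-- The coefficients of a `1`-chain at the four oriented `1`-cells of `Σ` issuing from the
`0`-cell `P y`, listed in counterclockwise order:
`e y`, `t (rotInv y)`, `e (anti y)`, `- t (rot y)`. -/
def outgoing (c : PreC1) (y : Dart) : Fin 4 → ℤ :=
  ![c.1 y, c.2 (rotInv y), c.1 (anti y), - c.2 (rot y)]

/-- The boundary operator on `1`-chains: a `1`-cell that issues from `P y` contributes `-1`. -/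
def bd1 : PreC1 →ₗ[ℤ] (Dart → ℤ) where
  toFun c y := - ∑ i, outgoing c y i
  map_add' a b := by
    funext y; simp [outgoing, Fin.sum_univ_four]; ring
  map_smul' r a := by
    funext y; simp [outgoing, Fin.sum_univ_four]; ring

/-- The boundary operator on `2`-chains: the boundary of the face with counterclockwise edges `y`
is the sum of the `e y - t (rotInv y)`. -/
def bd2 : (Dart → ℤ) →ₗ[ℤ] PreC1 where
  toFun f := (fun y => f y - f (rev y), fun y => f (rot (anti y)) - f (rot y))
  map_add' a b := by
    ext y <;> simp <;> ring
  map_smul' r a := by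
    ext y <;> simp <;> ring

/-- The action of the icosahedral group on `1`-chains. -/
noncomputable def preC1Rep : Representation ℤ Icosa PreC1 := (funRep Dart).prod (funRep Dart)

lemma preC1Rep_fst (g : Icosa) (c : PreC1) (y : Dart) : (preC1Rep g c).1 y = c.1 (g⁻¹ * y) := rfl

lemma preC1Rep_snd (g : Icosa) (c : PreC1) (y : Dart) : (preC1Rep g c).2 y = c.2 (g⁻¹ * y) := rfl

lemma bd1_mem {c : PreC1} (hc : c ∈ C1) : bd1 c ∈ C0 := by
  intro y
  have h := hc.2 (rot y)
  have h' := hc.2 (rotInv y)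
  simp only [anti_rot, anti_rotInv] at h h'
  simp only [bd1, outgoing, LinearMap.coe_mk, AddHom.coe_mk, Fin.sum_univ_four]
  simp [h, h']
  ring

lemma C2_rev {f : Dart → ℤ} (hf : f ∈ C2) (y : Dart) : f (rev y) = f (rotInv y) := by
  have := hf (rev y)
  simpa using this.symm

lemma bd2_mem {f : Dart → ℤ} (_hf : f ∈ C2) : bd2 f ∈ C1 :=
  ⟨fun y => by simp [bd2], fun y => by simp [bd2]⟩

/-- The coefficients around `P y` of a boundary are the differences of the coefficients of the
faces that meet there. -/
lemma outgoing_bd2 {f : Dart → ℤ} (hf : f ∈ C2) (y : Dart) : outgoing (bd2 f) y =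
    ![f y - f (rotInv y), f (rotInv (anti y)) - f y, f (anti y) - f (rotInv (anti y)),
      f (rotInv y) - f (anti y)] := by
  funext i
  fin_cases i <;> simp [outgoing, bd2, C2_rev hf]

lemma bd1_bd2 {f : Dart → ℤ} (hf : f ∈ C2) : bd1 (bd2 f) = 0 := by
  funext y
  simp only [bd1, LinearMap.coe_mk, AddHom.coe_mk, outgoing_bd2 hf, Fin.sum_univ_four]
  simp

/-- The module of `1`-cycles. -/
def Z1 : Submodule ℤ PreC1 := C1 ⊓ LinearMap.ker bd1

/-- The module of `1`-boundaries. -/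
def B1 : Submodule ℤ PreC1 := C2.map bd2

lemma B1_le_Z1 : B1 ≤ Z1 := by
  rintro _ ⟨f, hf, rfl⟩
  exact ⟨bd2_mem hf, bd1_bd2 hf⟩

lemma outgoing_preC1Rep (g : Icosa) (c : PreC1) (y : Dart) :
    outgoing (preC1Rep g c) y = outgoing c (g⁻¹ * y) := by
  simp [outgoing, preC1Rep_fst, preC1Rep_snd]

lemma Z1_le (g : Icosa) : Z1 ≤ Z1.comap (preC1Rep g) := by
  rintro c ⟨⟨h1, h2⟩, h3⟩
  refine ⟨⟨fun y => ?_, fun y => ?_⟩, ?_⟩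
  · simp [preC1Rep_fst, h1]
  · simp [preC1Rep_snd, h2]
  · have h3' : bd1 c = 0 := h3
    change bd1 (preC1Rep g c) = 0
    funext y
    have := congrFun h3' (g⁻¹ * y)
    simp only [bd1, LinearMap.coe_mk, AddHom.coe_mk, outgoing_preC1Rep] at this ⊢
    exact this

lemma preC1Rep_bd2 (g : Icosa) (f : Dart → ℤ) :
    preC1Rep g (bd2 f) = bd2 (funRep Dart g f) := by
  ext y
  · simp [preC1Rep_fst, bd2, funRep_apply]
  · simp [preC1Rep_snd, bd2, funRep_apply]

lemma B1_le (g : Icosa) : B1 ≤ B1.comap (preC1Rep g) := by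
  rintro _ ⟨f, hf, rfl⟩
  refine ⟨funRep Dart g f, fun y => ?_, (preC1Rep_bd2 g f).symm⟩
  have := hf (g⁻¹ * y)
  simpa [funRep_apply] using this

/-- The icosahedral group acts on the `1`-cycles. -/
noncomputable def Z1Rep : Representation ℤ Icosa Z1 := preC1Rep.subrepresentation Z1 Z1_le

/-- The first homology group of the surface `Σ`. -/
abbrev H1 : Type := Z1 ⧸ B1.submoduleOf Z1

/-- The icosahedral group acts on `H₁(Σ)`. -/
noncomputable def H1Rep : Representation ℤ Icosa H1 :=
  Z1Rep.quotient (B1.submoduleOf Z1) fun g _ hc => B1_le g hc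

/-! ### The intersection pairing

The intersection number of two cycles on the `1`-skeleton of an oriented surface is a sum of local
contributions of the `0`-cells. If `a 0, a 1, ...` and `b 0, b 1, ...` are the coefficients of the
two cycles at the oriented `1`-cells issuing from a `0`-cell, in counterclockwise order, then the
contribution is one half of the sum over `i < j` of `a i * b j - a j * b i`: two paths that cross
transversally contribute `1` or `-1` (`1` if the tangent directions of the first and the second
path form an oriented basis), and a common end of two paths counts for one half. -/

/-- Twice the local contribution at `P y` to the intersection number. -/
def localCross (a b : PreC1) (y : Dart) : ℤ :=
  ∑ i, ∑ j ∈ Finset.Ioi i,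
    (outgoing a y i * outgoing b y j - outgoing a y j * outgoing b y i)

lemma sum_Ioi_four (F : Fin 4 → Fin 4 → ℤ) :
    ∑ i, ∑ j ∈ Finset.Ioi i, F i j = F 0 1 + F 0 2 + F 0 3 + F 1 2 + F 1 3 + F 2 3 := by
  have h0 : Finset.Ioi (0 : Fin 4) = {1, 2, 3} := by decide
  have h1 : Finset.Ioi (1 : Fin 4) = {2, 3} := by decide
  have h2 : Finset.Ioi (2 : Fin 4) = {3} := by decide
  have h3 : Finset.Ioi (3 : Fin 4) = ∅ := by decide
  rw [Fin.sum_univ_four, h0, h1, h2, h3]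
  simp
  ring

lemma sum_outgoing {c : PreC1} (hc : c ∈ Z1) (y : Dart) : ∑ i, outgoing c y i = 0 := by
  have h : bd1 c = 0 := hc.2
  have := congrFun h y
  simpa [bd1] using this

lemma sum_mulRight (k : Dart) (h : Dart → ℤ) : ∑ y, h (y * k) = ∑ y, h y :=
  Fintype.sum_equiv (Equiv.mulRight k) _ _ fun _ => rfl

lemma sum_odd_eq_zero (k : Dart) (h : Dart → ℤ) (hh : ∀ y, h (y * k) = - h y) : ∑ y, h y = 0 := by
  have := sum_mulRight k h
  simp only [hh, Finset.sum_neg_distrib] at this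
  omega

lemma two_dvd_sum (k : Dart) (hk : k * k = 1) (hk1 : k ≠ 1) (h : Dart → ℤ)
    (hh : ∀ y, h (y * k) = h y) : (2 : ℤ) ∣ ∑ y, h y := by
  have : ((∑ y, h y : ℤ) : ZMod 2) = 0 := by
    push_cast
    refine Finset.sum_involution (fun y _ => y * k) (fun y _ => ?_) (fun y _ _ => ?_)
      (fun y _ => Finset.mem_univ _) (fun y _ => ?_)
    · rw [hh y]; exact CharTwo.add_self_eq_zero _
    · simpa using hk1
    · rw [mul_assoc, hk, mul_one]
  exact (ZMod.intCast_zmod_eq_zero_iff_dvd _ 2).1 this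

lemma four_dvd_sum_localCross {a b : PreC1} (ha : a ∈ Z1) (hb : b ∈ Z1) :
    (4 : ℤ) ∣ ∑ y, localCross a b y := by
  have hr : revElt * revElt = 1 := by decide
  have hr1 : revElt ≠ 1 := by decide
  have hn : antiElt * antiElt = 1 := by decide
  have hn1 : antiElt ≠ 1 := by decide
  let S : Dart → ℤ := fun y => outgoing a y 0 * (outgoing b y 1 + outgoing b y 2 + outgoing b y 3)
    + outgoing a y 1 * (outgoing b y 2 + outgoing b y 3) + outgoing a y 2 * outgoing b y 3
  have hS : (2 : ℤ) ∣ ∑ y, S y := by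
    refine two_dvd_sum antiElt hn hn1 S fun y => ?_
    have h1 := sum_outgoing ha y
    have h2 := sum_outgoing hb y
    have e1 := ha.1.2 (rot y)
    have e3 := hb.1.2 (rot y)
    have e4 := hb.1.2 (rotInv y)
    change S (anti y) = S y
    simp only [anti_rot, anti_rotInv] at e1 e3 e4
    simp only [Fin.sum_univ_four] at h1 h2
    simp [S, outgoing] at h1 h2 ⊢
    simp only [e1, e3, e4]
    have h1' : a.1 (anti y) = a.2 (rot y) - a.1 y - a.2 (rotInv y) := by linarith
    have h2' : b.1 (anti y) = b.2 (rot y) - b.1 y - b.2 (rotInv y) := by linarith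
    rw [h1', h2']
    ring
  have he : (2 : ℤ) ∣ ∑ y, a.1 y * b.1 y := by
    refine two_dvd_sum revElt hr hr1 _ fun y => ?_
    change a.1 (rev y) * b.1 (rev y) = _
    rw [ha.1.1, hb.1.1]; ring
  have ht : (2 : ℤ) ∣ ∑ y, a.2 y * b.2 y := by
    refine two_dvd_sum antiElt hn hn1 _ fun y => ?_
    change a.2 (anti y) * b.2 (anti y) = _
    rw [ha.1.2, hb.1.2]; ring
  have key : ∀ y, localCross a b y = 2 * S y + (a.1 y * b.1 y + a.2 (rotInv y) * b.2 (rotInv y)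
      + a.1 (anti y) * b.1 (anti y) + a.2 (rot y) * b.2 (rot y)) := by
    intro y
    have h1 := sum_outgoing ha y
    have h2 := sum_outgoing hb y
    simp only [Fin.sum_univ_four] at h1 h2
    rw [localCross, sum_Ioi_four]
    simp [S, outgoing] at h1 h2 ⊢
    have h1' : a.1 (anti y) = a.2 (rot y) - a.1 y - a.2 (rotInv y) := by linarith
    have h2' : b.1 (anti y) = b.2 (rot y) - b.1 y - b.2 (rotInv y) := by linarith
    rw [h1', h2']
    ring
  have s1 : ∑ y, a.1 (anti y) * b.1 (anti y) = ∑ y, a.1 y * b.1 y :=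
    sum_mulRight antiElt fun y => a.1 y * b.1 y
  have s2 : ∑ y, a.2 (rot y) * b.2 (rot y) = ∑ y, a.2 y * b.2 y :=
    sum_mulRight rotElt fun y => a.2 y * b.2 y
  have s3 : ∑ y, a.2 (rotInv y) * b.2 (rotInv y) = ∑ y, a.2 y * b.2 y :=
    sum_mulRight rotElt⁻¹ fun y => a.2 y * b.2 y
  simp only [key, Finset.sum_add_distrib, ← Finset.mul_sum, s1, s2, s3]
  omega

lemma localCross_add_left (a a' b : PreC1) (y : Dart) :
    localCross (a + a') b y = localCross a b y + localCross a' b y := by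
  simp [localCross, sum_Ioi_four, outgoing]; ring

lemma localCross_smul_left (r : ℤ) (a b : PreC1) (y : Dart) :
    localCross (r • a) b y = r * localCross a b y := by
  simp [localCross, sum_Ioi_four, outgoing]; ring

lemma localCross_swap (a b : PreC1) (y : Dart) : localCross b a y = - localCross a b y := by
  simp [localCross, sum_Ioi_four]; ring

/-- The intersection number of two `1`-cycles of `Σ`. Each `0`-cell is `P y` for two oriented edges
`y`, so the sum of all `localCross a b y` is four times the intersection number. -/
def cycleInter (a b : Z1) : ℤ := (∑ y, localCross a b y) / 4

lemma four_mul_cycleInter (a b : Z1) : 4 * cycleInter a b = ∑ y, localCross a b y :=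
  Int.mul_ediv_cancel' (four_dvd_sum_localCross a.2 b.2)

lemma cycleInter_add_left (a a' b : Z1) :
    cycleInter (a + a') b = cycleInter a b + cycleInter a' b := by
  have h := four_mul_cycleInter (a + a') b
  have h1 := four_mul_cycleInter a b
  have h2 := four_mul_cycleInter a' b
  simp only [Submodule.coe_add, localCross_add_left, Finset.sum_add_distrib] at h
  omega

lemma cycleInter_smul_left (r : ℤ) (a b : Z1) :
    cycleInter (r • a) b = r * cycleInter a b := by
  have h := four_mul_cycleInter (r • a) b
  have h1 := four_mul_cycleInter a b
  simp only [Submodule.coe_smul, localCross_smul_left, ← Finset.mul_sum] at h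
  rw [← h1] at h
  linarith

lemma cycleInter_swap (a b : Z1) : cycleInter b a = - cycleInter a b := by
  have h := four_mul_cycleInter b a
  have h1 := four_mul_cycleInter a b
  simp only [localCross_swap (a : PreC1) (b : PreC1), Finset.sum_neg_distrib] at h
  omega

lemma cycleInter_boundary (a b : Z1) (ha : (a : PreC1) ∈ B1) : cycleInter a b = 0 := by
  obtain ⟨f, hf, hfa⟩ := ha
  have h := four_mul_cycleInter a b
  have hb := b.2
  set c : PreC1 := (b : PreC1)
  have key : ∀ y, localCross a c y =
      (f (rev y) + f y) * c.1 y + (f y + f (rotInv (anti y))) * c.2 (rotInv y)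
      + (f (rev (anti y)) + f (anti y)) * c.1 (anti y)
      - (f (anti y) + f (rotInv y)) * c.2 (rot y) := by
    intro y
    have h2 := sum_outgoing hb y
    simp only [Fin.sum_univ_four] at h2
    rw [localCross, sum_Ioi_four, ← hfa, outgoing_bd2 hf, C2_rev hf, C2_rev hf]
    simp [outgoing] at h2 ⊢
    have h2' : c.1 (anti y) = c.2 (rot y) - c.1 y - c.2 (rotInv y) := by linarith
    rw [h2']
    ring
  have s0 : ∑ y, (f (rev y) + f y) * c.1 y = 0 := by
    refine sum_odd_eq_zero revElt _ fun y => ?_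
    change (f (rev (rev y)) + f (rev y)) * c.1 (rev y) = _
    rw [hb.1.1, rev_rev]; ring
  have s2 : ∑ y, (f (rev (anti y)) + f (anti y)) * c.1 (anti y) = 0 :=
    (sum_mulRight antiElt fun y => (f (rev y) + f y) * c.1 y).trans s0
  have t0 : ∑ y, (f (rot y) + f (rot (anti y))) * c.2 y = 0 := by
    refine sum_odd_eq_zero antiElt _ fun y => ?_
    change (f (rot (anti y)) + f (rot (anti (anti y)))) * c.2 (anti y) = _
    rw [hb.1.2, anti_anti]; ring
  have s1 : ∑ y, (f y + f (rotInv (anti y))) * c.2 (rotInv y) = 0 := by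
    refine Eq.trans ?_ t0
    rw [← sum_mulRight rotElt⁻¹ fun y => (f (rot y) + f (rot (anti y))) * c.2 y]
    refine Finset.sum_congr rfl fun y _ => ?_
    change _ = (f (rot (rotInv y)) + f (rot (anti (rotInv y)))) * c.2 (rotInv y)
    simp
  have s3 : ∑ y, (f (anti y) + f (rotInv y)) * c.2 (rot y) = 0 := by
    refine Eq.trans ?_ t0
    rw [← sum_mulRight rotElt fun y => (f (rot y) + f (rot (anti y))) * c.2 y]
    refine Finset.sum_congr rfl fun y _ => ?_
    change _ = (f (rot (rot y)) + f (rot (anti (rot y)))) * c.2 (rot y)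
    simp [add_comm]
  simp only [key, Finset.sum_add_distrib, Finset.sum_sub_distrib, s0, s1, s2, s3] at h
  omega

lemma cycleInter_Z1Rep (g : Icosa) (a b : Z1) :
    cycleInter (Z1Rep g a) (Z1Rep g b) = cycleInter a b := by
  have h := four_mul_cycleInter (Z1Rep g a) (Z1Rep g b)
  have h1 := four_mul_cycleInter a b
  have e : ∑ y, localCross (Z1Rep g a : PreC1) (Z1Rep g b : PreC1) y =
      ∑ y, localCross (a : PreC1) (b : PreC1) y := by
    refine Fintype.sum_equiv (Equiv.mulLeft g⁻¹) _ _ fun y => ?_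
    change localCross (preC1Rep g a) (preC1Rep g b) y = localCross (a : PreC1) b (g⁻¹ * y)
    simp only [localCross, outgoing_preC1Rep]
  rw [e] at h
  omega

/-- The intersection pairing on the `1`-cycles as a bilinear form. -/
def cycleForm : Z1 →ₗ[ℤ] Z1 →ₗ[ℤ] ℤ :=
  LinearMap.mk₂ ℤ cycleInter cycleInter_add_left
    (fun r a b => cycleInter_smul_left r a b)
    (fun a b b' => by
      rw [cycleInter_swap, cycleInter_add_left, cycleInter_swap a b, cycleInter_swap a b']; ring)
    (fun r a b => by
      rw [cycleInter_swap, cycleInter_smul_left, cycleInter_swap a b, smul_eq_mul]; ring)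

/-- The intersection pairing on `H₁(Σ)`. -/
def interForm : H1 →ₗ[ℤ] H1 →ₗ[ℤ] ℤ :=
  (B1.submoduleOf Z1).liftQ
    (((B1.submoduleOf Z1).liftQ cycleForm.flip fun b hb => by
      refine LinearMap.ext fun a => ?_
      change cycleInter a b = 0
      rw [cycleInter_swap, cycleInter_boundary b a hb, neg_zero]).flip)
    fun a ha => by
      refine LinearMap.ext fun b => ?_
      obtain ⟨b, rfl⟩ := Submodule.Quotient.mk_surjective _ b
      exact cycleInter_boundary a b ha

lemma interForm_mk (a b : Z1) :
    interForm (Submodule.Quotient.mk a) (Submodule.Quotient.mk b) = cycleInter a b := rfl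

lemma interForm_H1Rep (g : Icosa) (a b : H1) :
    interForm (H1Rep g a) (H1Rep g b) = interForm a b := by
  obtain ⟨a, rfl⟩ := Submodule.Quotient.mk_surjective _ a
  obtain ⟨b, rfl⟩ := Submodule.Quotient.mk_surjective _ b
  exact cycleInter_Z1Rep g a b

/-! ### Vanishing cycles and vanishing lattices -/

/-- The oriented `1`-cell `e y` as a `1`-chain. -/
def edgeCell (y : Dart) : PreC1 := (Pi.single y 1 - Pi.single (rev y) 1, 0)

/-- The oriented `1`-cell `t y` as a `1`-chain. -/
def trcCell (y : Dart) : PreC1 := (0, Pi.single y 1 - Pi.single (anti y) 1)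

/-- The loop of edge type `e y - e (anti y)`: it runs from `P y` to `P (rev y)` along the edge `y`
and returns to `P y` along the opposite edge. -/
def edgeLoop (y : Dart) : PreC1 := edgeCell y - edgeCell (anti y)

/-- The loop of truncation type around the initial point of `y`: the counterclockwise boundary of
the triangle that was removed there. -/
def trcLoop (y : Dart) : PreC1 := trcCell y + trcCell (rot y) + trcCell (rotInv y)

lemma single_inv_mul (g y z : Dart) :
    (Pi.single y 1 : Dart → ℤ) (g⁻¹ * z) = (Pi.single (g * y) 1 : Dart → ℤ) z := by
  simp only [Pi.single_apply, inv_mul_eq_iff_eq_mul]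

lemma preC1Rep_edgeLoop (g : Icosa) (y : Dart) :
    preC1Rep g (edgeLoop y) = edgeLoop (g * y) := by
  ext z
  · simp [preC1Rep_fst, edgeLoop, edgeCell, single_inv_mul]
  · simp [preC1Rep_snd, edgeLoop, edgeCell]

lemma preC1Rep_trcLoop (g : Icosa) (y : Dart) :
    preC1Rep g (trcLoop y) = trcLoop (g * y) := by
  ext z
  · simp [preC1Rep_fst, trcLoop, trcCell]
  · simp [preC1Rep_snd, trcLoop, trcCell, single_inv_mul]

lemma rev_eq_iff (y z : Dart) : rev z = y ↔ z = rev y :=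
  ⟨fun h => by rw [← h, rev_rev], fun h => by rw [h, rev_rev]⟩

lemma anti_eq_iff (y z : Dart) : anti z = y ↔ z = anti y :=
  ⟨fun h => by rw [← h, anti_anti], fun h => by rw [h, anti_anti]⟩

lemma rot_eq_iff (y z : Dart) : rot z = y ↔ z = rotInv y :=
  ⟨fun h => by rw [← h, rotInv_rot], fun h => by rw [h, rot_rotInv]⟩

lemma rotInv_eq_iff (y z : Dart) : rotInv z = y ↔ z = rot y :=
  ⟨fun h => by rw [← h, rot_rotInv], fun h => by rw [h, rotInv_rot]⟩

lemma edgeLoop_mem (y : Dart) : edgeLoop y ∈ Z1 := by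
  refine ⟨⟨fun z => ?_, fun z => ?_⟩, ?_⟩
  · simp [edgeLoop, edgeCell, Pi.single_apply, rev_eq_iff]; ring
  · simp [edgeLoop, edgeCell]
  · change bd1 (edgeLoop y) = 0
    funext z
    simp [bd1, outgoing, Fin.sum_univ_four, edgeLoop, edgeCell, Pi.single_apply, anti_eq_iff]

lemma trcLoop_mem (y : Dart) : trcLoop y ∈ Z1 := by
  refine ⟨⟨fun z => ?_, fun z => ?_⟩, ?_⟩
  · simp [trcLoop, trcCell]
  · simp [trcLoop, trcCell, Pi.single_apply, anti_eq_iff]; ring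
  · change bd1 (trcLoop y) = 0
    funext z
    simp [bd1, outgoing, Fin.sum_univ_four, trcLoop, trcCell, Pi.single_apply, rot_eq_iff,
      rotInv_eq_iff]
    ring

/-- The homology class of the loop of edge type defined by `y`; these classes are the vanishing
cycles of the degeneration of `Σ` that contracts every loop of edge type to a point. -/
def edgeCycle (y : Dart) : H1 := Submodule.Quotient.mk ⟨edgeLoop y, edgeLoop_mem y⟩

/-- The homology class of the loop of truncation type at the initial point of `y`; these classes
are the vanishing cycles of the degeneration of `Σ` that contracts every loop of truncation type
to a point. -/
def trcCycle (y : Dart) : H1 := Submodule.Quotient.mk ⟨trcLoop y, trcLoop_mem y⟩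

lemma H1Rep_edgeCycle (g : Icosa) (y : Dart) : H1Rep g (edgeCycle y) = edgeCycle (g * y) :=
  congrArg Submodule.Quotient.mk (Subtype.ext (preC1Rep_edgeLoop g y))

lemma H1Rep_trcCycle (g : Icosa) (y : Dart) : H1Rep g (trcCycle y) = trcCycle (g * y) :=
  congrArg Submodule.Quotient.mk (Subtype.ext (preC1Rep_trcLoop g y))

lemma span_range_invariant (d : Dart → H1) (hd : ∀ g y, H1Rep g (d y) = d (g * y)) (g : Icosa)
    ⦃v : H1⦄ (hv : v ∈ Submodule.span ℤ (Set.range d)) :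
    H1Rep g v ∈ Submodule.span ℤ (Set.range d) := by
  have : Submodule.span ℤ (Set.range d) ≤ (Submodule.span ℤ (Set.range d)).comap (H1Rep g) := by
    rw [Submodule.span_le]
    rintro _ ⟨y, rfl⟩
    change H1Rep g (d y) ∈ Submodule.span ℤ (Set.range d)
    rw [hd]
    exact Submodule.subset_span ⟨_, rfl⟩
  exact this hv

/-- The vanishing lattice `L_edge`, spanned by the vanishing cycles of edge type. -/
noncomputable def Ledge : Subrepresentation H1Rep where
  toSubmodule := Submodule.span ℤ (Set.range edgeCycle)
  apply_mem_toSubmodule := span_range_invariant edgeCycle H1Rep_edgeCycle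

/-- The vanishing lattice `L_trc`, spanned by the vanishing cycles of truncation type. -/
noncomputable def Ltrc : Subrepresentation H1Rep where
  toSubmodule := Submodule.span ℤ (Set.range trcCycle)
  apply_mem_toSubmodule := span_range_invariant trcCycle H1Rep_trcCycle

/-- `L_edge` is the kernel of `H₁(Σ) → H₁(Σ_edge)`, where `Σ_edge` is obtained from `Σ` by
contracting every loop of edge type to a point: the `1`-cells of `Σ_edge` are those of truncation
type, and its `2`-cells are those of `Σ`. -/
theorem mk_mem_Ledge_iff (z : Z1) : (Submodule.Quotient.mk z : H1) ∈ Ledge.toSubmodule ↔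
    ∃ f ∈ C2, (bd2 f).2 = (z : PreC1).2 := by
  constructor
  · intro h
    let K : Submodule ℤ PreC1 := C2.map bd2 ⊔ LinearMap.ker (LinearMap.snd ℤ (Dart → ℤ) (Dart → ℤ))
    have hK : Ledge.toSubmodule ≤ (K.submoduleOf Z1).map (B1.submoduleOf Z1).mkQ := by
      refine Submodule.span_le.2 ?_
      rintro _ ⟨y, rfl⟩
      refine ⟨⟨edgeLoop y, edgeLoop_mem y⟩, Submodule.mem_sup_right ?_, rfl⟩
      simp [edgeLoop, edgeCell]
    obtain ⟨w, hw, hwz⟩ := hK h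
    have hwz' : w - z ∈ B1.submoduleOf Z1 := (Submodule.Quotient.eq (B1.submoduleOf Z1)).1 hwz
    obtain ⟨f, hf, hfw⟩ : (w : PreC1) - z ∈ B1 := hwz'
    obtain ⟨_, ⟨f', hf', rfl⟩, k, hk, hkw⟩ := Submodule.mem_sup.1 (show (w : PreC1) ∈ K from hw)
    refine ⟨f' - f, C2.sub_mem hf' hf, ?_⟩
    have hk2 : k.2 = 0 := hk
    rw [map_sub, hfw, ← hkw]
    simp [hk2]
  · rintro ⟨f, hf, hfz⟩
    have hz := z.2
    let u : PreC1 := (z : PreC1) - bd2 f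
    have hu : u ∈ Z1 := Z1.sub_mem hz (B1_le_Z1 ⟨f, hf, rfl⟩)
    have hu2 : u.2 = 0 := by simp [u, hfz]
    have hanti : ∀ y, u.1 (anti y) = - u.1 y := fun y => by
      have := sum_outgoing hu y
      simp only [Fin.sum_univ_four] at this
      simp [outgoing, hu2] at this
      linarith
    have hrev : ∀ y, u.1 (rev y) = - u.1 y := hu.1.1
    let R : Finset Dart := Finset.univ.filter fun y =>
      (y : Equiv.Perm (Fin 5)) 0 < (y : Equiv.Perm (Fin 5)) 1 ∧
      (y : Equiv.Perm (Fin 5)) 0 < (y : Equiv.Perm (Fin 5)) 2 ∧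
      (y : Equiv.Perm (Fin 5)) 0 < (y : Equiv.Perm (Fin 5)) 3
    have hR : ∀ y : Dart, (if y ∈ R then 1 else 0) + (if rev y ∈ R then 1 else 0)
        + (if anti y ∈ R then 1 else 0) + (if rev (anti y) ∈ R then 1 else 0) = (1 : ℤ) := by
      decide
    have hsum : u = ∑ y ∈ R, u.1 y • edgeLoop y := by
      refine Prod.ext ?_ ?_
      · funext x
        have h := hR x
        simp only [Prod.fst_sum, Finset.sum_apply, Prod.smul_fst, Pi.smul_apply, edgeLoop, edgeCell,
          Prod.fst_sub, Pi.sub_apply, Pi.single_apply, smul_eq_mul, mul_sub, Finset.sum_sub_distrib,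
          mul_ite, mul_one, mul_zero]
        have e1 : ∀ y, (x = rev y) = (rev x = y) := fun y => propext (by rw [rev_eq_iff])
        have e2 : ∀ y, (x = anti y) = (anti x = y) := fun y => propext (by rw [anti_eq_iff])
        have e3 : ∀ y, (rev x = anti y) = (rev (anti x) = y) := fun y => propext (by
          rw [← anti_eq_iff, anti_rev])
        simp only [e1, e2, e3, Finset.sum_ite_eq, hrev, hanti]
        split_ifs at h ⊢ <;> simp at h ⊢
      · simp [hu2, edgeLoop, edgeCell, Prod.snd_sum]
    have hmk : (Submodule.Quotient.mk z : H1) =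
        ∑ y ∈ R, u.1 y • edgeCycle y := by
      have : (⟨u, hu⟩ : Z1) = ∑ y ∈ R, u.1 y • (⟨edgeLoop y, edgeLoop_mem y⟩ : Z1) := by
        apply Subtype.ext
        simpa using hsum
      have h2 : (Submodule.Quotient.mk z : H1) = Submodule.Quotient.mk ⟨u, hu⟩ :=
        (Submodule.Quotient.eq _).2 ⟨f, hf, by simp [u]⟩
      rw [h2, this]
      exact map_sum ((B1.submoduleOf Z1).mkQ) _ _
    rw [hmk]
    exact Submodule.sum_mem _ fun y _ => Submodule.smul_mem _ _ (Submodule.subset_span ⟨y, rfl⟩)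

/-- `L_trc` is the kernel of `H₁(Σ) → H₁(Σ_trc)`, where `Σ_trc` is obtained from `Σ` by
contracting every loop of truncation type to a point: the `1`-cells of `Σ_trc` are those of edge
type, and its `2`-cells are those of `Σ`. -/
theorem mk_mem_Ltrc_iff (z : Z1) : (Submodule.Quotient.mk z : H1) ∈ Ltrc.toSubmodule ↔
    ∃ f ∈ C2, (bd2 f).1 = (z : PreC1).1 := by
  constructor
  · intro h
    let K : Submodule ℤ PreC1 := C2.map bd2 ⊔ LinearMap.ker (LinearMap.fst ℤ (Dart → ℤ) (Dart → ℤ))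
    have hK : Ltrc.toSubmodule ≤ (K.submoduleOf Z1).map (B1.submoduleOf Z1).mkQ := by
      refine Submodule.span_le.2 ?_
      rintro _ ⟨y, rfl⟩
      refine ⟨⟨trcLoop y, trcLoop_mem y⟩, Submodule.mem_sup_right ?_, rfl⟩
      simp [trcLoop, trcCell]
    obtain ⟨w, hw, hwz⟩ := hK h
    have hwz' : w - z ∈ B1.submoduleOf Z1 := (Submodule.Quotient.eq (B1.submoduleOf Z1)).1 hwz
    obtain ⟨f, hf, hfw⟩ : (w : PreC1) - z ∈ B1 := hwz'
    obtain ⟨_, ⟨f', hf', rfl⟩, k, hk, hkw⟩ := Submodule.mem_sup.1 (show (w : PreC1) ∈ K from hw)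
    refine ⟨f' - f, C2.sub_mem hf' hf, ?_⟩
    have hk2 : k.1 = 0 := hk
    rw [map_sub, hfw, ← hkw]
    simp [hk2]
  · rintro ⟨f, hf, hfz⟩
    have hz := z.2
    let u : PreC1 := (z : PreC1) - bd2 f
    have hu : u ∈ Z1 := Z1.sub_mem hz (B1_le_Z1 ⟨f, hf, rfl⟩)
    have hu2 : u.1 = 0 := by simp [u, hfz]
    have hrot' : ∀ y, u.2 (rotInv y) = u.2 (rot y) := fun y => by
      have := sum_outgoing hu y
      simp only [Fin.sum_univ_four] at this
      simp [outgoing, hu2] at this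
      linarith
    have hrot : ∀ y, u.2 (rot y) = u.2 y := fun y => by
      simpa using (hrot' (rotInv y))
    have hrotInv : ∀ y, u.2 (rotInv y) = u.2 y := fun y => (hrot' y).trans (hrot y)
    have hanti : ∀ y, u.2 (anti y) = - u.2 y := hu.1.2
    let R : Finset Dart := Finset.univ.filter fun y =>
      (y : Equiv.Perm (Fin 5)) 0 < (y : Equiv.Perm (Fin 5)) 1 ∧
      (y : Equiv.Perm (Fin 5)) 2 < (y : Equiv.Perm (Fin 5)) 3 ∧
      (y : Equiv.Perm (Fin 5)) 2 < (y : Equiv.Perm (Fin 5)) 4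
    have hR : ∀ y : Dart, (if y ∈ R then 1 else 0) + (if rot y ∈ R then 1 else 0)
        + (if rotInv y ∈ R then 1 else 0) + (if anti y ∈ R then 1 else 0)
        + (if rot (anti y) ∈ R then 1 else 0) + (if rotInv (anti y) ∈ R then 1 else 0)
        = (1 : ℤ) := by
      decide
    have hsum : u = ∑ y ∈ R, u.2 y • trcLoop y := by
      refine Prod.ext ?_ ?_
      · simp [hu2, trcLoop, trcCell, Prod.fst_sum]
      · funext x
        have h := congrArg (fun n => u.2 x * n) (hR x)
        simp only [Prod.snd_sum, Finset.sum_apply, Prod.smul_snd, Pi.smul_apply, trcLoop, trcCell,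
          Prod.snd_add, Pi.sub_apply, Pi.add_apply, Pi.single_apply, smul_eq_mul,
          mul_sub, mul_add, Finset.sum_sub_distrib, Finset.sum_add_distrib, mul_ite, mul_one,
          mul_zero, anti_rot, anti_rotInv] at h ⊢
        have e1 : ∀ w y, (w = rot y) = (rotInv w = y) := fun w y =>
          propext (by rw [rotInv_eq_iff])
        have e2 : ∀ w y, (w = rotInv y) = (rot w = y) := fun w y => propext (by rw [rot_eq_iff])
        have e3 : ∀ w y, (w = anti y) = (anti w = y) := fun w y => propext (by rw [anti_eq_iff])
        simp only [e1, e2, e3, Finset.sum_ite_eq, hrot, hrotInv, hanti, anti_rot, anti_rotInv]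
        have hneg : ∀ w : Dart, (if w ∈ R then - u.2 x else 0) = -(if w ∈ R then u.2 x else 0) :=
          fun w => by split_ifs <;> simp
        simp only [hneg]
        linarith
    have hmk : (Submodule.Quotient.mk z : H1) =
        ∑ y ∈ R, u.2 y • trcCycle y := by
      have : (⟨u, hu⟩ : Z1) = ∑ y ∈ R, u.2 y • (⟨trcLoop y, trcLoop_mem y⟩ : Z1) := by
        apply Subtype.ext
        simpa using hsum
      have h2 : (Submodule.Quotient.mk z : H1) = Submodule.Quotient.mk ⟨u, hu⟩ :=
        (Submodule.Quotient.eq _).2 ⟨f, hf, by simp [u]⟩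
      rw [h2, this]
      exact map_sum ((B1.submoduleOf Z1).mkQ) _ _
    rw [hmk]
    exact Submodule.sum_mem _ fun y _ => Submodule.smul_mem _ _ (Submodule.subset_span ⟨y, rfl⟩)

/-! ### The natural maps -/

/-- The inclusion of an invariant sublattice in `H₁(Σ)`. -/
noncomputable def incl (L : Subrepresentation H1Rep) :
    Representation.IntertwiningMap L.toRepresentation H1Rep where
  toLinearMap := L.toSubmodule.subtype
  isIntertwining' _ := rfl

/-- The map `φ : H₁(Σ) → L^∨` that takes `h` to the linear form `l ↦ ⟨h, l⟩` on `L`. -/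
noncomputable def phi (L : Subrepresentation H1Rep) :
    Representation.IntertwiningMap H1Rep L.toRepresentation.dual where
  toLinearMap := (LinearMap.lcomp ℤ ℤ L.toSubmodule.subtype).comp interForm
  isIntertwining' g := by
    refine LinearMap.ext fun h => LinearMap.ext fun l => ?_
    change interForm (H1Rep g h) l = interForm h (H1Rep g⁻¹ l)
    rw [← interForm_H1Rep g h]
    congr 1
    rw [← Module.End.mul_apply, ← map_mul, mul_inv_cancel, map_one, Module.End.one_apply]

/-- The map `Hom_{ℤI}(V_o, L) → Hom_{ℤI}(V_o, H₁(Σ))` induced by the inclusion. -/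
noncomputable def homIncl (L : Subrepresentation H1Rep) :
    Representation.IntertwiningMap VoRep L.toRepresentation →ₗ[ℤ]
      Representation.IntertwiningMap VoRep H1Rep :=
  Representation.IntertwiningMap.llcomp VoRep L.toRepresentation H1Rep (incl L)

/-- The map `Hom_{ℤI}(V_o, H₁(Σ)) → Hom_{ℤI}(V_o, L^∨)` induced by `φ`. -/
noncomputable def homPhi (L : Subrepresentation H1Rep) :
    Representation.IntertwiningMap VoRep H1Rep →ₗ[ℤ]
      Representation.IntertwiningMap VoRep L.toRepresentation.dual :=
  Representation.IntertwiningMap.llcomp VoRep H1Rep L.toRepresentation.dual (phi L)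

end Winger

/-!
Both vanishing lattices are their own orthogonal complements in `H₁(Σ)`
(`mem_Ltrc_iff_orthogonal`, `mem_Ledge_iff_orthogonal`), so that `0 → L → H₁(Σ) → L^∨` is exact, and
the left exact functor `Hom(V_o, _)` leaves only the surjectivity to be shown. For `L_trc` the
orthogonality relations say that the coefficients of edge type of a cycle form a cocycle on the dual
cell complex of the dodecahedron. That complex is a sphere, hence the cocycle is a coboundary
(`exists_C2_of_sum_rot_eq_zero`); `mk_mem_Ltrc_iff` does the rest. For `L_edge` they say that the
coefficients of truncation type form an odd function on the faces.

For the surjectivity, an equivariant map `ψ : V_o → L^∨` is determined by the five integers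
`ψ (e_i) (δ_1)`, where `i` runs over the cubes and `δ_1` is a single vanishing cycle, because the
icosahedral group acts simply transitively on oriented edges. The symmetries of the vanishing
cycles under `rot` and `anti`, respectively `rev` and `anti`, leave only the multiples of one vector:
`(1, -1, 0, 0, 0)` for `L_trc` and `(1, -1, -1, 1, 0)` for `L_edge`. It remains to find an equivariant
map `V_o → H₁(Σ)` that realizes this vector up to sign.

These maps come from the other lattice. For `L_edge`, the cube `a` is sent to the sum of the four
loops of truncation type around the vertices `(a, b)`. For `L_trc` it is sent to a sum of four loops
of edge type, one through each vertex `(a, b)`, chosen invariantly under the Klein four-group in the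
stabilizer of `a`. The choice is not invariant under the whole stabilizer, but the homology class is:
its threefold equals the sum over all twelve edges issuing from the vertices `(a, b)`, as one sees
from an explicit `2`-chain (`three_smul_cubeCycle_edgeCycle`), and `H₁(Σ)` is torsion-free
(`H1_eq_zero_of_smul_eq_zero`). The invariant cycles alone would give only the
multiples of `3`.
-/

namespace Winger

/-! ### The faces of the dodecahedron -/

/-- The counterclockwise successor of an oriented edge in the boundary of the face on its left. -/
def faceNext (y : Dart) : Dart := rotInv (rev y)

lemma C2_iterate_faceNext {f : Dart → ℤ} (hf : f ∈ C2) (k : ℕ) (y : Dart) :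
    f (faceNext^[k] y) = f y := by
  induction k with
  | zero => rfl
  | succ k ih => rw [Function.iterate_succ_apply', ← ih]; exact hf _

/-- A path that visits each of the twelve faces once: its `j`-th face, for `j < 12`, is the face on
the left of `spiral j`, and for `j < 11` the path crosses the edge `spiral j` to reach the next
face. The list records by how many edges one turns inside the face that has been entered. -/
def spiral : ℕ → Dart
  | 0 => 1
  | j + 1 => faceNext^[[1, 2, 2, 2, 4, 2, 4, 1, 2, 2].getD j 0] (rev (spiral j))

lemma exists_spiral_eq :
    ∀ y : Dart, ∃ j : Fin 12, ∃ k : Fin 5, faceNext^[(k : ℕ)] (spiral j) = y := by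
  decide +kernel

/-- The position in the path `spiral` of the face on the left of an oriented edge. -/
def faceIndex (y : Dart) : ℕ :=
  ∑ j ∈ Finset.range 12, if ∃ k : Fin 5, faceNext^[(k : ℕ)] (spiral j) = y then j else 0

lemma faceIndex_faceNext : ∀ y, faceIndex (faceNext y) = faceIndex y := by decide +kernel

lemma faceIndex_spiral : ∀ j < 12, faceIndex (spiral j) = j := by decide +kernel

lemma faceIndex_rev_spiral : ∀ j < 11, faceIndex (rev (spiral j)) = j + 1 := by decide +kernel

/-- The set `Z` together with the oriented edges at which, by a single relation, a function must
vanish that vanishes on `Z`, is odd under `rev`, and has sum zero around every vertex. -/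
def vanishStep (Z : Finset Dart) : Finset Dart :=
  Finset.univ.filter fun y => y ∈ Z ∨ rev y ∈ Z ∨ (rot y ∈ Z ∧ rotInv y ∈ Z)

lemma mem_iterate_vanishStep :
    ∀ y, y ∈ vanishStep^[14] ((Finset.range 11).image spiral) := by decide +kernel

/-- The dual cell complex of the dodecahedron is simply connected: an odd function on oriented edges
with sum zero around every vertex is the coboundary of a function on faces. Integration along the
path `spiral` makes the function vanish on the edges that are crossed by this path, and then
everywhere. -/
lemma exists_C2_of_sum_rot_eq_zero {u : Dart → ℤ} (hrev : ∀ y, u (rev y) = - u y)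
    (hrot : ∀ y, u y + u (rot y) + u (rotInv y) = 0) :
    ∃ f ∈ C2, ∀ y, f y - f (rev y) = u y := by
  let f : Dart → ℤ := fun y => - ∑ j ∈ Finset.range (faceIndex y), u (spiral j)
  have hf : f ∈ C2 := fun y => by
    change f (faceNext y) = f y
    simp only [f, faceIndex_faceNext]
  refine ⟨f, hf, fun y => ?_⟩
  let w : Dart → ℤ := fun y => f y - f (rev y) - u y
  have hstep : ∀ Z : Finset Dart, (∀ y ∈ Z, w y = 0) → ∀ y ∈ vanishStep Z, w y = 0 := by
    have hwrev : ∀ y, w (rev y) = - w y := fun y => by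
      simp only [w, hrev, rev_rev]; ring
    have hwrot : ∀ y, w y + w (rot y) + w (rotInv y) = 0 := fun y => by
      have h := hrot y
      simp only [w, C2_rev hf, rotInv_rot, rotInv_rotInv]
      linarith
    intro Z hZ y hy
    rcases (Finset.mem_filter.1 hy).2 with h | h | ⟨h, h'⟩
    · exact hZ y h
    · have := hZ _ h
      rw [hwrev] at this
      linarith
    · have := hwrot y
      rw [hZ _ h, hZ _ h'] at this
      linarith
  have hiter : ∀ n, ∀ y ∈ vanishStep^[n] ((Finset.range 11).image spiral), w y = 0 := by
    intro n
    induction n with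
    | zero =>
      intro y hy
      obtain ⟨j, hj, rfl⟩ := Finset.mem_image.1 hy
      have hj := Finset.mem_range.1 hj
      simp [w, f, faceIndex_spiral j (by omega), faceIndex_rev_spiral j hj, Finset.sum_range_succ]
    | succ n ih =>
      rw [Function.iterate_succ_apply']
      exact hstep _ ih
  have := hiter 14 y (mem_iterate_vanishStep y)
  simp only [w] at this
  linarith

/-- The faces of the dodecahedron are connected through edges: if the values of a `2`-chain on
adjacent faces are congruent, then all its values are. -/
lemma dvd_C2_sub {f : Dart → ℤ} (hf : f ∈ C2) {n : ℤ} (h : ∀ y, n ∣ f y - f (rev y)) (y : Dart) :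
    n ∣ f y - f 1 := by
  have hs : ∀ j, n ∣ f (spiral j) - f 1 := by
    intro j
    induction j with
    | zero => simp [spiral]
    | succ j ih =>
      have := dvd_sub ih (h (spiral j))
      rw [spiral, C2_iterate_faceNext hf]
      rwa [show f (rev (spiral j)) - f 1 =
        f (spiral j) - f 1 - (f (spiral j) - f (rev (spiral j))) by ring]
  obtain ⟨j, k, rfl⟩ := exists_spiral_eq y
  rw [C2_iterate_faceNext hf]
  exact hs j

/-- `H₁(Σ)` is torsion-free. -/
lemma H1_eq_zero_of_smul_eq_zero {n : ℤ} (hn : n ≠ 0) {h : H1} (hh : n • h = 0) : h = 0 := by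
  obtain ⟨c, rfl⟩ := Submodule.Quotient.mk_surjective _ h
  obtain ⟨f, hf, hfc⟩ : n • (c : PreC1) ∈ B1 :=
    (Submodule.Quotient.mk_eq_zero (B1.submoduleOf Z1) (x := n • c)).1 hh
  have h1 : ∀ y, f y - f (rev y) = n * (c : PreC1).1 y := fun y => congrFun (congrArg Prod.fst hfc) y
  have hd := dvd_C2_sub hf fun y => Dvd.intro _ (h1 y).symm
  choose q hq using hd
  have hf' : ∀ y, f y = f 1 + n * q y := fun y => by linarith [hq y]
  refine (Submodule.Quotient.mk_eq_zero _).2 ⟨q, fun y => ?_, ?_⟩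
  · have := hf y
    rw [hf', hf' y] at this
    exact mul_left_cancel₀ hn (by linarith)
  · refine smul_right_injective PreC1 hn ?_
    change n • bd2 q = n • (c : PreC1)
    rw [← hfc]
    ext y
    · simp only [bd2, LinearMap.coe_mk, AddHom.coe_mk, Prod.smul_fst, Pi.smul_apply, smul_eq_mul]
      rw [hf' y, hf' (rev y)]; ring
    · simp only [bd2, LinearMap.coe_mk, AddHom.coe_mk, Prod.smul_snd, Pi.smul_apply, smul_eq_mul]
      rw [hf' (rot (anti y)), hf' (rot y)]; ring

/-! ### Intersection numbers with the vanishing cycles -/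

/-- Only the edges that issue from a vertex cross the loop around it. -/
lemma cycleInter_trcLoop (c : Z1) (y : Dart) :
    cycleInter c ⟨trcLoop y, trcLoop_mem y⟩ =
      (c : PreC1).1 y + (c : PreC1).1 (rot y) + (c : PreC1).1 (rotInv y) := by
  have h := four_mul_cycleInter c ⟨trcLoop y, trcLoop_mem y⟩
  generalize cycleInter c _ = n at h ⊢
  have hc := sum_outgoing c.2
  have ht := c.2.1.2
  have e0 := hc y
  have e1 := hc (rot y)
  have e2 := hc (rotInv y)
  have t0 := ht y
  have t1 := ht (rot y)
  have t2 := ht (rotInv y)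
  simp only [localCross, sum_Ioi_four] at h
  simp [outgoing, trcLoop, trcCell, Pi.single_apply, rotInv_eq_iff, rot_eq_iff,
    mul_add, mul_sub, Finset.sum_add_distrib, Finset.sum_sub_distrib] at h
  simp [outgoing, Fin.sum_univ_four] at e0 e1 e2 t0 t1 t2
  linarith

/-- A loop of edge type is crossed at its two `0`-cells only, by the `1`-cells of truncation type
on one of its sides. -/
lemma cycleInter_edgeLoop (c : Z1) (y : Dart) :
    cycleInter c ⟨edgeLoop y, edgeLoop_mem y⟩ =
      (c : PreC1).2 (rot (rev y)) - (c : PreC1).2 (rotInv y) := by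
  have h := four_mul_cycleInter c ⟨edgeLoop y, edgeLoop_mem y⟩
  generalize cycleInter c _ = n at h ⊢
  have hc := sum_outgoing c.2
  have ht := c.2.1.2
  have hr := c.2.1.1
  have e0 := hc y
  have e1 := hc (rev y)
  have r0 := hr y
  have r1 := hr (anti y)
  have t0 := ht (rot y)
  have t1 := ht (rotInv y)
  have t2 := ht (rot (rev y))
  have t3 := ht (rotInv (rev y))
  simp only [localCross, sum_Ioi_four] at h
  simp [outgoing, edgeLoop, edgeCell, Pi.single_apply, anti_eq_iff,
    mul_sub, Finset.sum_add_distrib, Finset.sum_sub_distrib] at h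
  simp [outgoing, Fin.sum_univ_four] at e0 e1 r0 r1 t0 t1 t2 t3
  linarith

/-! ### The vanishing lattices are their own orthogonal complements -/

lemma interForm_swap (a b : H1) : interForm b a = - interForm a b := by
  obtain ⟨a, rfl⟩ := Submodule.Quotient.mk_surjective _ a
  obtain ⟨b, rfl⟩ := Submodule.Quotient.mk_surjective _ b
  exact cycleInter_swap a b

lemma forall_mem_span_interForm_eq_zero {d : Dart → H1} {h : H1}
    (hd : ∀ y, interForm h (d y) = 0) :
    ∀ l ∈ Submodule.span ℤ (Set.range d), interForm h l = 0 := by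
  intro l hl
  have : Submodule.span ℤ (Set.range d) ≤ LinearMap.ker (interForm h) := by
    rw [Submodule.span_le]
    rintro _ ⟨y, rfl⟩
    exact hd y
  exact this hl

lemma mem_span_iff_orthogonal {d : Dart → H1} (hd : ∀ y z, interForm (d y) (d z) = 0)
    (hmax : ∀ h : H1, (∀ y, interForm h (d y) = 0) → h ∈ Submodule.span ℤ (Set.range d)) (h : H1) :
    h ∈ Submodule.span ℤ (Set.range d) ↔
      ∀ l ∈ Submodule.span ℤ (Set.range d), interForm h l = 0 := by
  refine ⟨fun hh => forall_mem_span_interForm_eq_zero fun y => ?_,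
    fun hh => hmax h fun y => hh _ (Submodule.subset_span ⟨y, rfl⟩)⟩
  rw [interForm_swap, forall_mem_span_interForm_eq_zero (hd y) h hh, neg_zero]

/-- A cycle that meets no loop of truncation type has total coefficient zero at the edges that issue
from a vertex, hence agrees up to a boundary with a cycle without `1`-cells of edge type. -/
lemma mem_Ltrc_iff_orthogonal (h : H1) :
    h ∈ Ltrc.toSubmodule ↔ ∀ l ∈ Ltrc.toSubmodule, interForm h l = 0 := by
  refine mem_span_iff_orthogonal (fun y z => ?_) (fun h hh => ?_) h
  · refine (cycleInter_trcLoop _ z).trans ?_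
    simp [trcLoop, trcCell]
  · obtain ⟨c, rfl⟩ := Submodule.Quotient.mk_surjective _ h
    obtain ⟨f, hf, hfc⟩ := exists_C2_of_sum_rot_eq_zero c.2.1.1
      fun y => (cycleInter_trcLoop c y).symm.trans (hh y)
    exact (mk_mem_Ltrc_iff c).2 ⟨f, hf, funext hfc⟩

/-- For a cycle that meets no loop of edge type the coefficients of truncation type define an
odd function on the faces, which can be removed by a boundary supported on one face of each
antipodal pair. -/
lemma mem_Ledge_iff_orthogonal (h : H1) :
    h ∈ Ledge.toSubmodule ↔ ∀ l ∈ Ledge.toSubmodule, interForm h l = 0 := by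
  refine mem_span_iff_orthogonal (fun y z => ?_) (fun h hh => ?_) h
  · refine (cycleInter_edgeLoop _ z).trans ?_
    simp [edgeLoop, edgeCell]
  · obtain ⟨c, rfl⟩ := Submodule.Quotient.mk_surjective _ h
    refine (mk_mem_Ledge_iff c).2 ?_
    have hs : ∀ y, (c : PreC1).2 (rot (rev y)) = (c : PreC1).2 (rotInv y) := fun y =>
      sub_eq_zero.1 ((cycleInter_edgeLoop c y).symm.trans (hh y))
    let s : Dart → ℤ := fun y => (c : PreC1).2 (rotInv y)
    have hsC2 : s ∈ C2 := fun y => by simp [s, hs]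
    -- The face on the left of `rev (anti y)` is opposite to the face on the left of `y`.
    let opp : Dart → Dart := fun y => rev (anti y)
    have hnext : ∀ y, faceNext (opp y) = rotInv (anti y) := fun y => by simp [faceNext, opp]
    have hopp : ∀ y, faceNext (opp (faceNext y)) = opp y := fun y => by simp [faceNext, opp]
    have hoppopp : ∀ y, opp (opp y) = y := fun y => by simp [opp]
    have hsopp : ∀ y, s (opp y) = - s y := fun y => by
      rw [← hsC2 (opp y)]
      change s (faceNext (opp y)) = _
      have := c.2.1.2 (rotInv y)
      simp only [anti_rotInv] at this
      simp only [hnext, s, rotInv_rotInv, this]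
    have hne : ∀ y, faceIndex y ≠ faceIndex (opp y) := by decide +kernel
    have hindex : ∀ y, faceIndex (opp (faceNext y)) = faceIndex (opp y) := fun y => by
      rw [← faceIndex_faceNext, hopp]
    let f : Dart → ℤ := fun y => if faceIndex y < faceIndex (opp y) then - s y else 0
    have hf : f ∈ C2 := fun y => by
      change f (faceNext y) = f y
      simp only [f, hindex, faceIndex_faceNext]
      rw [show s (faceNext y) = s y from hsC2 y]
    refine ⟨f, hf, funext fun z => ?_⟩
    change f (rot (anti z)) - f (rot z) = (c : PreC1).2 z
    have h1 : rot (anti z) = faceNext (opp (rot z)) := by simp [hnext]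
    rw [h1, show f (faceNext (opp (rot z))) = f (opp (rot z)) from hf _,
      show (c : PreC1).2 z = s (rot z) by simp [s]]
    simp only [f, hoppopp, hsopp]
    rcases lt_or_gt_of_ne (hne (rot z)) with h | h
    · simp [h, h.not_gt]
    · simp [h, h.not_gt]

/-! ### Equivariant maps on `V_o` -/

/-- The class in `V_o` of the inscribed cube `a`. -/
def cubeClass (a : Fin 5) : Vo := Submodule.Quotient.mk (Pi.single a 1)

lemma VoRep_cubeClass (g : Icosa) (a : Fin 5) :
    VoRep g (cubeClass a) = cubeClass ((g : Equiv.Perm (Fin 5)) a) := by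
  refine congrArg Submodule.Quotient.mk ?_
  funext x
  have : ((g⁻¹ : Icosa) • x = a) = (x = (g : Equiv.Perm (Fin 5)) a) := by
    rw [inv_smul_eq_iff]; rfl
  simp only [funRep_apply, Pi.single_apply, this]

lemma Vo_hom_ext {M : Type*} [AddCommGroup M] {f f' : Vo →ₗ[ℤ] M}
    (h : ∀ a, f (cubeClass a) = f' (cubeClass a)) : f = f' :=
  Submodule.linearMap_qext _ ((Pi.basisFun ℤ (Fin 5)).ext fun a => by simpa [cubeClass] using h a)

/-- An equivariant map on `V_o` is given by the images of the five cubes; these must be permuted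
by the icosahedral group and have sum zero. -/
def homOfCubes {M : Type*} [AddCommGroup M] (ρ : Representation ℤ Icosa M) (E : Fin 5 → M)
    (hE : ∀ g a, ρ g (E a) = E ((g : Equiv.Perm (Fin 5)) a)) (hsum : ∑ a, E a = 0) :
    Representation.IntertwiningMap VoRep ρ where
  toLinearMap := constLine.liftQ (Fintype.linearCombination ℤ E) (by
    rw [constLine, Submodule.span_le]
    rintro _ rfl
    simp [Fintype.linearCombination_apply, hsum])
  isIntertwining' g := by
    refine Vo_hom_ext fun a => ?_
    rw [LinearMap.comp_apply, LinearMap.comp_apply, VoRep_cubeClass]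
    simp [cubeClass, Fintype.linearCombination_apply_single, hE]

lemma homOfCubes_cubeClass {M : Type*} [AddCommGroup M] (ρ : Representation ℤ Icosa M)
    (E : Fin 5 → M) (hE : ∀ g a, ρ g (E a) = E ((g : Equiv.Perm (Fin 5)) a))
    (hsum : ∑ a, E a = 0) (a : Fin 5) : homOfCubes ρ E hE hsum (cubeClass a) = E a := by
  change constLine.liftQ _ _ (cubeClass a) = _
  simp [cubeClass, Fintype.linearCombination_apply_single]

/-! ### The cycle of a cube -/

/-- The indicator function of the oriented edges `(a, b, c, d, e)` that begin at a vertex `(a, b)`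
of the cube `a`. -/
def startsOn (a : Fin 5) (y : Dart) : ℤ :=
  if (y : Equiv.Perm (Fin 5)) 0 = a then 1 else 0

/-- The indicator function of a choice of one of the three oriented edges that begin at a vertex
`(a, b)`, for each `b ≠ a`: those `(a, b, c, d, e)` with `b + c = 2 a` in `ℤ / 5`. As the condition
depends only on the partition `{b, c}, {d, e}`, these four oriented edges are an orbit of the Klein
four-group that fixes `a`. -/
def marked (a : Fin 5) (y : Dart) : ℤ :=
  let p : Equiv.Perm (Fin 5) := y
  if p 0 = a ∧ p 1 + p 2 = 2 * a then 1 else 0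

/-- The sum of the four vanishing cycles in a family `d` that belong to the edges chosen by
`marked a`. -/
def cubeCycle (d : Dart → H1) (a : Fin 5) : H1 := ∑ y, marked a y • d y

lemma marked_add_rot : ∀ a y, marked a y + marked a (rot y) + marked a (rotInv y) = startsOn a y := by
  decide +kernel

lemma sum_comp_mul_right_smul (k : Dart) (μ : Dart → ℤ) (d : Dart → H1) :
    ∑ y, μ (y * k) • d y = ∑ y, μ y • d (y * k⁻¹) :=
  Fintype.sum_equiv (Equiv.mulRight k) _ _ fun y => by simp

lemma H1Rep_sum_startsOn {d : Dart → H1} (hd : ∀ g y, H1Rep g (d y) = d (g * y)) (g : Icosa)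
    (a : Fin 5) : H1Rep g (∑ y, startsOn a y • d y) =
      ∑ y, startsOn ((g : Equiv.Perm (Fin 5)) a) y • d y := by
  simp only [map_sum, map_smul, hd]
  refine Fintype.sum_equiv (Equiv.mulLeft g) _ _ fun y => ?_
  simp [startsOn]

/-- The threefold of a cycle `cubeCycle d a` is a sum over all oriented edges that begin on the cube
`a`, which does not involve choices. As `H₁(Σ)` is torsion-free, the choices do not matter. -/
lemma H1Rep_cubeCycle {d : Dart → H1} (hd : ∀ g y, H1Rep g (d y) = d (g * y))
    (h3 : ∀ a, (3 : ℤ) • cubeCycle d a = ∑ y, startsOn a y • d y) (g : Icosa) (a : Fin 5) :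
    H1Rep g (cubeCycle d a) = cubeCycle d ((g : Equiv.Perm (Fin 5)) a) := by
  refine sub_eq_zero.1 (H1_eq_zero_of_smul_eq_zero three_ne_zero ?_)
  rw [smul_sub, ← map_smul, h3, h3, H1Rep_sum_startsOn hd, sub_self]

/-- Six times the sum is twice the sum of `d` over all oriented edges, in which `y` and `anti y`
cancel. -/
lemma sum_cubeCycle {d : Dart → H1} (hanti : ∀ y, d (anti y) = - d y)
    (h3 : ∀ a, (3 : ℤ) • cubeCycle d a = ∑ y, startsOn a y • d y) : ∑ a, cubeCycle d a = 0 := by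
  refine H1_eq_zero_of_smul_eq_zero (n := 6) (by norm_num) ?_
  have h : (3 : ℤ) • ∑ a, cubeCycle d a = ∑ y, d y := by
    simp only [Finset.smul_sum, h3]
    rw [Finset.sum_comm]
    simp [startsOn]
  have h' : ∑ y, d y = - ∑ y, d y := by
    rw [← Finset.sum_neg_distrib]
    simp only [← hanti]
    exact (Fintype.sum_equiv (Equiv.mulRight antiElt) _ _ fun _ => rfl).symm
  rw [show (6 : ℤ) = 3 + 3 by norm_num, add_smul, h]
  nth_rw 1 [h']
  exact neg_add_cancel _

lemma trcCycle_rot (y : Dart) : trcCycle (rot y) = trcCycle y := by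
  refine congrArg Submodule.Quotient.mk (Subtype.ext ?_)
  simp only [trcLoop, rot_rot, rotInv_rot]
  abel

lemma trcCycle_anti (y : Dart) : trcCycle (anti y) = - trcCycle y := by
  refine congrArg Submodule.Quotient.mk (Subtype.ext ?_)
  ext z <;> simp [trcLoop, trcCell]
  ring

lemma edgeCycle_rev (y : Dart) : edgeCycle (rev y) = - edgeCycle y := by
  refine congrArg Submodule.Quotient.mk (Subtype.ext ?_)
  ext z <;> simp [edgeLoop, edgeCell]
  ring

lemma edgeCycle_anti (y : Dart) : edgeCycle (anti y) = - edgeCycle y := by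
  refine congrArg Submodule.Quotient.mk (Subtype.ext ?_)
  ext z <;> simp [edgeLoop, edgeCell]

lemma three_smul_cubeCycle_trcCycle (a : Fin 5) :
    (3 : ℤ) • cubeCycle trcCycle a = ∑ y, startsOn a y • trcCycle y := by
  have h1 : ∑ y, marked a (rot y) • trcCycle y = cubeCycle trcCycle a :=
    (sum_comp_mul_right_smul rotElt _ _).trans <| Finset.sum_congr rfl fun y _ => by
      rw [← trcCycle_rot (y * rotElt⁻¹)]
      simp [rot]
  have h2 : ∑ y, marked a (rotInv y) • trcCycle y = cubeCycle trcCycle a :=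
    (sum_comp_mul_right_smul rotElt⁻¹ _ _).trans <| Finset.sum_congr rfl fun y _ => by
      rw [inv_inv]
      exact congrArg _ (trcCycle_rot y)
  simp only [← marked_add_rot, add_smul, Finset.sum_add_distrib, h1, h2]
  rw [← cubeCycle, ← one_smul ℤ (cubeCycle trcCycle a), smul_smul, ← add_smul, ← add_smul]
  norm_num

/-- A labelling by `1`, `-1` and `0` of the faces of the dodecahedron that depends on a cube `a`.
Among the oriented edges on the boundary of a face there is exactly one `(b, c, d, e, a)` with last
entry `a`. The label is `1`, `-1` or `0` according to whether `c`, `d` or `e` is the entry `x` with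
`b + x = 2 a` in `ℤ / 5`. Modulo `3` and up to a constant, this is the coordinate of the face in the
quotient of order `3` of the stabilizer of `a`, which permutes the faces simply transitively. -/
def faceLabel (a : Fin 5) (y : Dart) : ℤ :=
  ∑ k : Fin 5,
    let p : Equiv.Perm (Fin 5) := (faceNext^[(k : ℕ)] y : Dart)
    if p 4 = a then (if p 0 + p 1 = 2 * a then 1 else if p 0 + p 2 = 2 * a then -1 else 0) else 0

lemma faceLabel_mem_C2 (a : Fin 5) : faceLabel a ∈ C2 := by
  intro y
  revert a y
  decide +kernel

lemma faceLabel_rot_anti : ∀ a y, faceLabel a (rot (anti y)) = faceLabel a (rot y) := by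
  decide +kernel

lemma three_mul_marked : ∀ a y, 3 * (marked a y - marked a (rev y) - marked a (anti y)
      + marked a (rev (anti y))) =
    startsOn a y - startsOn a (rev y) - startsOn a (anti y) + startsOn a (rev (anti y))
      + (faceLabel a y - faceLabel a (rev y)) := by
  decide +kernel

lemma sum_smul_edgeLoop (μ : Dart → ℤ) : ∑ y, μ y • edgeLoop y =
    (fun y => μ y - μ (rev y) - μ (anti y) + μ (rev (anti y)), 0) := by
  refine Prod.ext (funext fun x => ?_) ?_
  · have e1 : ∀ y, (x = rev y) = (rev x = y) := fun y => propext (by rw [rev_eq_iff])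
    have e2 : ∀ y, (x = anti y) = (anti x = y) := fun y => propext (by rw [anti_eq_iff])
    have e3 : ∀ y, (rev x = anti y) = (rev (anti x) = y) := fun y => propext (by
      rw [← anti_eq_iff, anti_rev])
    simp [Prod.fst_sum, edgeLoop, edgeCell, Pi.single_apply, mul_sub, e1, e2, e3]
    ring
  · simp [Prod.snd_sum, edgeLoop, edgeCell]

/-- The two sides differ by the boundary of the `2`-chain `faceLabel a`. -/
lemma three_smul_cubeCycle_edgeCycle (a : Fin 5) :
    (3 : ℤ) • cubeCycle edgeCycle a = ∑ y, startsOn a y • edgeCycle y := by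
  have hmk : ∀ μ : Dart → ℤ, ∑ y, μ y • edgeCycle y =
      Submodule.Quotient.mk (∑ y, μ y • (⟨edgeLoop y, edgeLoop_mem y⟩ : Z1)) := fun μ =>
    (map_sum (B1.submoduleOf Z1).mkQ (fun y => μ y • (⟨edgeLoop y, edgeLoop_mem y⟩ : Z1)) _).symm
  rw [cubeCycle, hmk, hmk, ← Submodule.Quotient.mk_smul]
  refine (Submodule.Quotient.eq _).2 ⟨faceLabel a, faceLabel_mem_C2 a, ?_⟩
  simp only [map_sub, map_smul, map_sum, Submodule.subtype_apply, sum_smul_edgeLoop]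
  ext y
  · have := three_mul_marked a y
    simp [bd2]
    linarith
  · simp [bd2, faceLabel_rot_anti]

/-! ### Surjectivity -/

/-- The value of an equivariant map `V_o → L^∨` at a vanishing cycle depends only on the position
of a cube in the oriented edge. -/
lemma dual_apply_eq {L : Subrepresentation H1Rep} {d : Dart → H1}
    (hd : ∀ g y, H1Rep g (d y) = d (g * y)) (hdL : ∀ y, d y ∈ L.toSubmodule)
    (ψ : Representation.IntertwiningMap VoRep L.toRepresentation.dual) (a : Fin 5) (y : Dart) :
    ψ (cubeClass a) ⟨d y, hdL y⟩ =
      ψ (cubeClass ((y : Equiv.Perm (Fin 5))⁻¹ a)) ⟨d 1, hdL 1⟩ := by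
  have h := LinearMap.congr_fun
    (Representation.IntertwiningMap.isIntertwining _ _ ψ (y⁻¹ : Icosa) (cubeClass a)) ⟨d 1, hdL 1⟩
  rw [VoRep_cubeClass] at h
  refine Eq.trans ?_ h.symm
  change _ = ψ (cubeClass a) (L.toRepresentation (y⁻¹)⁻¹ ⟨d 1, hdL 1⟩)
  congr 1
  refine Subtype.ext ?_
  change d y = H1Rep (y⁻¹)⁻¹ (d 1)
  rw [hd, inv_inv, mul_one]

/-- A criterion for surjectivity. In `hs`, the function `v` stands for `i ↦ ψ (cubeClass i) (d 1)`,
where `ψ` is an equivariant map `V_o → L^∨`; every symmetry `d k = ε • d 1` gives a relation between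
its values. -/
lemma homPhi_surjective {L : Subrepresentation H1Rep} {d : Dart → H1}
    (hd : ∀ g y, H1Rep g (d y) = d (g * y))
    (hL : L.toSubmodule = Submodule.span ℤ (Set.range d))
    (Θ : Representation.IntertwiningMap VoRep H1Rep) (s : Fin 5 → ℤ)
    (hΘ : ∀ a y, interForm (Θ (cubeClass a)) (d y) = s ((y : Equiv.Perm (Fin 5))⁻¹ a))
    (hs : ∀ v : Fin 5 → ℤ, (∀ k : Icosa, ∀ ε : ℤ, d k = ε • d 1 →
      ∀ i, v i = ε * v ((k : Equiv.Perm (Fin 5)) i)) → ∃ n : ℤ, ∀ i, v i = n * s i) :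
    Function.Surjective (homPhi L) := by
  have hdL : ∀ y, d y ∈ L.toSubmodule := fun y => hL ▸ Submodule.subset_span ⟨y, rfl⟩
  intro ψ
  obtain ⟨n, hn⟩ := hs (fun i => ψ (cubeClass i) ⟨d 1, hdL 1⟩) fun k ε hk i => by
    have h := dual_apply_eq hd hdL ψ ((k : Equiv.Perm (Fin 5)) i) k
    rw [show (k : Equiv.Perm (Fin 5))⁻¹ ((k : Equiv.Perm (Fin 5)) i) = i from
        Equiv.symm_apply_apply _ _,
      show (⟨d k, hdL k⟩ : L.toSubmodule) = ε • ⟨d 1, hdL 1⟩ from Subtype.ext hk] at h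
    exact h.symm.trans (map_smul (ψ (cubeClass _)) ε _)
  refine ⟨n • Θ, Representation.IntertwiningMap.ext (Vo_hom_ext fun a => LinearMap.ext ?_)⟩
  rintro ⟨l, hl⟩
  have key : ∀ l (hl : l ∈ Submodule.span ℤ (Set.range d)),
      n * interForm (Θ (cubeClass a)) l = ψ (cubeClass a) ⟨l, hL.ge hl⟩ := by
    intro l hl
    induction hl using Submodule.span_induction with
    | mem l hl =>
      obtain ⟨y, rfl⟩ := hl
      rw [hΘ, dual_apply_eq hd hdL, hn]
    | zero => rw [map_zero, mul_zero]; exact (map_zero (ψ (cubeClass a))).symm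
    | add l l' hl hl' h h' =>
      rw [map_add, mul_add, h, h']
      exact (map_add (ψ (cubeClass a)) ⟨l, hL.ge hl⟩ ⟨l', hL.ge hl'⟩).symm
    | smul r l hl h =>
      rw [map_smul, smul_eq_mul, mul_left_comm, h]
      exact (map_smul (ψ (cubeClass a)) r ⟨l, hL.ge hl⟩).symm
  refine Eq.trans ?_ (key l (hL.le hl))
  change interForm (n • Θ (cubeClass a)) l = _
  simp

/-- The coefficients of edge type of the cycle `cubeCycle edgeCycle a`. -/
lemma sum_marked_mul_edgeLoop (a : Fin 5) (z : Dart) :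
    ∑ y, marked a y * (edgeLoop y).1 z =
      marked a z - marked a (rev z) - marked a (anti z) + marked a (rev (anti z)) := by
  have := congrFun (congrArg Prod.fst (sum_smul_edgeLoop (marked a))) z
  simpa [Prod.fst_sum] using this

lemma homPhi_Ltrc_surjective : Function.Surjective (homPhi Ltrc) := by
  refine homPhi_surjective H1Rep_trcCycle rfl
    (homOfCubes H1Rep (cubeCycle edgeCycle)
      (H1Rep_cubeCycle H1Rep_edgeCycle three_smul_cubeCycle_edgeCycle)
      (sum_cubeCycle edgeCycle_anti three_smul_cubeCycle_edgeCycle))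
    ![1, -1, 0, 0, 0] (fun a z => ?_) fun v hv => ⟨v 0, ?_⟩
  · have hpair : ∀ y, interForm (edgeCycle y) (trcCycle z) = (edgeLoop y).1 z
        + (edgeLoop y).1 (rot z) + (edgeLoop y).1 (rotInv z) := fun y => cycleInter_trcLoop _ z
    have h : ∀ a z,
        let c : Dart → ℤ := fun z =>
          marked a z - marked a (rev z) - marked a (anti z) + marked a (rev (anti z))
        c z + c (rot z) + c (rotInv z) =
        (![1, -1, 0, 0, 0] : Fin 5 → ℤ) ((z : Equiv.Perm (Fin 5))⁻¹ a) := by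
      decide +kernel
    rw [homOfCubes_cubeClass, cubeCycle, ← h]
    simp only [map_sum, map_smul, LinearMap.sum_apply, LinearMap.smul_apply, hpair, smul_eq_mul,
      mul_add, Finset.sum_add_distrib, sum_marked_mul_edgeLoop]
  · have h1 := hv rotElt 1 (by rw [one_smul]; exact trcCycle_rot 1)
    have h2 := hv antiElt (-1) (by rw [neg_one_smul]; exact trcCycle_anti 1)
    have r2 : v 2 = 1 * v 3 := h1 2
    have r3 : v 3 = 1 * v 4 := h1 3
    have a0 : v 0 = -1 * v 1 := h2 0
    have a4 : v 4 = -1 * v 4 := h2 4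
    intro i
    fin_cases i <;> simp <;> omega

/-- The coefficients of truncation type of the cycle `cubeCycle trcCycle a`: the loop around the
vertex `(p, q)` occurs with coefficient `1` if `p = a` and with coefficient `-1` if `q = a`. -/
lemma sum_marked_mul_trcLoop (a : Fin 5) (z : Dart) :
    ∑ y, marked a y * (trcLoop y).2 z = startsOn a z - startsOn a (anti z) := by
  have e1 : ∀ w y, (w = rot y) = (rotInv w = y) := fun w y => propext (by rw [rotInv_eq_iff])
  have e2 : ∀ w y, (w = rotInv y) = (rot w = y) := fun w y => propext (by rw [rot_eq_iff])
  have e3 : ∀ w y, (w = anti y) = (anti w = y) := fun w y => propext (by rw [anti_eq_iff])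
  simp [trcLoop, trcCell, Pi.single_apply, mul_add, mul_sub, Finset.sum_add_distrib, e1, e2, e3,
    ← marked_add_rot]
  ring

lemma homPhi_Ledge_surjective : Function.Surjective (homPhi Ledge) := by
  refine homPhi_surjective H1Rep_edgeCycle rfl
    (homOfCubes H1Rep (cubeCycle trcCycle)
      (H1Rep_cubeCycle H1Rep_trcCycle three_smul_cubeCycle_trcCycle)
      (sum_cubeCycle trcCycle_anti three_smul_cubeCycle_trcCycle))
    ![-1, 1, 1, -1, 0] (fun a z => ?_) fun v hv => ⟨- v 0, ?_⟩
  · have hpair : ∀ y, interForm (trcCycle y) (edgeCycle z) =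
        (trcLoop y).2 (rot (rev z)) - (trcLoop y).2 (rotInv z) := fun y => cycleInter_edgeLoop _ z
    have h : ∀ a z,
        let c : Dart → ℤ := fun z => startsOn a z - startsOn a (anti z)
        c (rot (rev z)) - c (rotInv z) =
          (![-1, 1, 1, -1, 0] : Fin 5 → ℤ) ((z : Equiv.Perm (Fin 5))⁻¹ a) := by
      decide +kernel
    rw [homOfCubes_cubeClass, cubeCycle, ← h]
    simp only [map_sum, map_smul, LinearMap.sum_apply, LinearMap.smul_apply, hpair, smul_eq_mul,
      mul_sub, Finset.sum_sub_distrib, sum_marked_mul_trcLoop]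
  · have h1 := hv revElt (-1) (by rw [neg_one_smul]; exact edgeCycle_rev 1)
    have h2 := hv antiElt (-1) (by rw [neg_one_smul]; exact edgeCycle_anti 1)
    have r0 : v 0 = -1 * v 2 := h1 0
    have r1 : v 1 = -1 * v 3 := h1 1
    have a0 : v 0 = -1 * v 1 := h2 0
    have a4 : v 4 = -1 * v 4 := h2 4
    intro i
    fin_cases i <;> simp <;> omega

/-! ### Exactness -/

lemma homIncl_injective (L : Subrepresentation H1Rep) : Function.Injective (homIncl L) :=
  fun _ _ h => DFunLike.ext _ _ fun v => Subtype.ext (DFunLike.congr_fun h v)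

/-- As `Hom(V_o, _)` is left exact, exactness in the middle holds already before it is applied. -/
lemma exact_homIncl_homPhi {L : Subrepresentation H1Rep}
    (hL : ∀ h, h ∈ L.toSubmodule ↔ ∀ l ∈ L.toSubmodule, interForm h l = 0) :
    Function.Exact (homIncl L) (homPhi L) := by
  intro f
  constructor
  · intro h
    have hf : ∀ v, f v ∈ L.toSubmodule := fun v => (hL _).2 fun l hl =>
      LinearMap.congr_fun (DFunLike.congr_fun h v) (⟨l, hl⟩ : L.toSubmodule)
    refine ⟨⟨f.toLinearMap.codRestrict L.toSubmodule hf, fun g => LinearMap.ext fun v => ?_⟩, rfl⟩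
    exact Subtype.ext (Representation.IntertwiningMap.isIntertwining _ _ f g v)
  · rintro ⟨f, rfl⟩
    refine DFunLike.ext _ _ fun v => LinearMap.ext fun l => ?_
    exact (hL _).1 (f v).2 l l.2

end Winger

theorem mainTheorem7 (L : Subrepresentation Winger.H1Rep)
    (hL : L = Winger.Ledge ∨ L = Winger.Ltrc) :
    Function.Injective (Winger.homIncl L) ∧
      Function.Exact (Winger.homIncl L) (Winger.homPhi L) ∧
      Function.Surjective (Winger.homPhi L) := by
  refine ⟨Winger.homIncl_injective L, ?_⟩
  rcases hL with rfl | rfl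
  · exact ⟨Winger.exact_homIncl_homPhi Winger.mem_Ledge_iff_orthogonal,
      Winger.homPhi_Ledge_surjective⟩
  · exact ⟨Winger.exact_homIncl_homPhi Winger.mem_Ltrc_iff_orthogonal,
      Winger.homPhi_Ltrc_surjective⟩
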